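/- **Conventions.** An A-space is a topological space in which arbitrary intersections of open sets are open; it is preordered by $x\le y$ iff $x$ lies in every open set containing $y$, and this is a partial order iff the space is $T_0$. A covering $p:E\to B$ is a surjective continuous map such that every point of $B$ has an evenly covered open neighbourhood; two coverings $p:E\to B$, $p':E'\to B$ are equivalent if there is a homeomorphism $h:E\to E'$ with $p'h=p$. A simplicial complex $K$ has a geometric realization $|K|$, endowed with the weak (coherent) topology; a simplicial map $\varphi:L\to K$ induces $|\varphi|:|L|\to|K|$ and is called a simplicial covering if $|\varphi|$ is a covering; a covering of $K$ means a covering of $|K|$. For a $T_0$ A-space $X$, the order complex $\mathcal K(X)$ is the simplicial complex of non-empty finite chains of $X$, and a continuous map $f:X\to Y$ of $T_0$ A-spaces induces a simplicial map $\mathcal K(f):\mathcal K(X)\to\mathcal K(Y)$ which is $f$ on vertices. For a simplicial complex $K$, the face poset $\mathcal X(K)$ is the set of simplices of $K$ ordered by inclusion, with the topology whose open sets are the down-sets; a simplicial map $\varphi:L\to K$ induces $\mathcal X(\varphi):\mathcal X(L)\to\mathcal X(K)$, $\sigma\mapsto\varphi(\sigma)$. **Theorem.** (1) Let $B$ be a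 $T_0$ A-space. If $p:E\to B$ is a covering, then $E$ is a $T_0$ A-space and $|\mathcal K(p)|:|\mathcal K(E)|\to|\mathcal K(B)|$ is a covering. Moreover, $[p]\mapsto[\,|\mathcal K(p)|\,]$ is a well-defined bijection from the equivalence classes of coverings of $B$ to the equivalence classes of coverings of $|\mathcal K(B)|$. (2) Let $K$ be a simplicial complex. If $\varphi:L\to K$ is a simplicial covering, then $\mathcal X(\varphi):\mathcal X(L)\to\mathcal X(K)$ is a covering. Moreover, every covering of $|K|$ is equivalent to $|\varphi|$ for some simplicial covering $\varphi:L\to K$, and $[\,|\varphi|\,]\mapsto[\mathcal X(\varphi)]$ is a well-defined bijection from the equivalence classes of coverings of $|K|$ to the equivalence classes of coverings of $\mathcal X(K)$. -/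

import Mathlib

universe u v

namespace PosetCov

open Topology

/-! ### Coverings and their equivalence classes -/

/-- A covering: every point of the base has an evenly covered open neighbourhood, and the map is
surjective (`IsCoveringMap` alone would allow empty fibres). -/
def IsCovering {E : Type v} {B : Type u} [TopologicalSpace E] [TopologicalSpace B]
    (p : E → B) : Prop :=
  IsCoveringMap p ∧ Function.Surjective p

/-- A covering of `B`, together with its total space. -/
structure Covering (B : Type u) [TopologicalSpace B] where
  /-- The total space. -/
  total : Type v
  /-- The topology of the total space. -/
  [top : TopologicalSpace total]
  /-- The covering map. -/
  proj : total → B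
  isCovering : IsCovering proj

attribute [instance] Covering.top

/-- Two coverings `p`, `p'` of `B` are equivalent if there is a homeomorphism `h` between their
total spaces such that `p' h = p`. -/
instance Covering.setoid (B : Type u) [TopologicalSpace B] : Setoid (Covering.{u, v} B) where
  r c c' := ∃ h : c.total ≃ₜ c'.total, ∀ e, c'.proj (h e) = c.proj e
  iseqv :=
    { refl := fun c => ⟨Homeomorph.refl _, fun _ => rfl⟩
      symm := by
        rintro c c' ⟨h, hh⟩
        refine ⟨h.symm, fun e => ?_⟩
        rw [← hh, h.apply_symm_apply]
      trans := by
        rintro c c' c'' ⟨h, hh⟩ ⟨k, hk⟩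
        exact ⟨h.trans k, fun e => (hk (h e)).trans (hh e)⟩ }

/-- Equivalence classes of coverings of `B`. -/
def CoveringClass (B : Type u) [TopologicalSpace B] : Type (max u (v + 1)) :=
  Quotient (Covering.setoid.{u, v} B)

/-- The equivalence class of a covering. -/
def CoveringClass.mk {B : Type u} [TopologicalSpace B] {E : Type v} [TopologicalSpace E]
    (p : E → B) (hp : IsCovering p) : CoveringClass.{u, v} B :=
  Quotient.mk (Covering.setoid.{u, v} B) ⟨E, p, hp⟩

/-! ### Simplicial maps -/

open Classical in
/-- A simplicial map: a map of vertices that sends simplices to simplices. -/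
structure SimplicialMap {W : Type v} {V : Type u} (L : AbstractSimplicialComplex W)
    (K : AbstractSimplicialComplex V) where
  /-- The map of vertices. -/
  toFun : W → V
  image_mem : ∀ s ∈ L, s.image toFun ∈ K

/-! ### Geometric realization -/

/-- The geometric realization `|K|`: its points are given by their barycentric coordinates. -/
@[ext]
structure Realization {V : Type u} (K : AbstractSimplicialComplex V) : Type u where
  /-- The barycentric coordinates. -/
  coord : V →₀ ℝ
  nonneg : ∀ v, 0 ≤ coord v
  sum_eq_one : (coord.sum fun _ a => a) = 1
  support_mem : coord.support ∈ K

/-- The closed simplex spanned by `s`, as a subset of `|K|`. -/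
def closedSimplex {V : Type u} (K : AbstractSimplicialComplex V) (s : Finset V) :
    Set (Realization K) :=
  {x | x.coord.support ⊆ s}

/-- The Euclidean topology of a closed simplex, i.e. the topology of convergence of the
barycentric coordinates. -/
@[reducible]
def closedSimplexTopology {V : Type u} (K : AbstractSimplicialComplex V) (s : Finset V) :
    TopologicalSpace (closedSimplex K s) :=
  TopologicalSpace.induced (fun x v => x.1.coord v) (inferInstanceAs (TopologicalSpace (V → ℝ)))

/-- The weak (coherent) topology of `|K|`: a set is open if and only if its intersection with every
closed simplex is open in that simplex. -/
instance {V : Type u} (K : AbstractSimplicialComplex V) : TopologicalSpace (Realization K) :=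
  ⨆ s : {s : Finset V // s ∈ K},
    TopologicalSpace.coinduced Subtype.val (closedSimplexTopology K s.1)

theorem realization_isOpen_iff {V : Type u} (K : AbstractSimplicialComplex V)
    (U : Set (Realization K)) :
    IsOpen U ↔ ∀ s ∈ K, ∃ O : Set (V → ℝ), IsOpen O ∧
      ∀ x : Realization K, x.coord.support ⊆ s → ((fun v => x.coord v) ∈ O ↔ x ∈ U) := by
  rw [isOpen_iSup_iff]
  simp only [isOpen_coinduced, Subtype.forall]
  refine forall₂_congr fun s _ => ?_
  refine exists_congr fun O => and_congr_right fun _ => ?_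
  constructor
  · intro h x hx
    exact Set.ext_iff.1 h ⟨x, hx⟩
  · intro h
    ext x
    exact h x.1 x.2

/-- The map `|φ| : |L| → |K|`, affine on simplices, induced by a simplicial map `φ`. -/
noncomputable def SimplicialMap.realization {W : Type v} {V : Type u}
    {L : AbstractSimplicialComplex W} {K : AbstractSimplicialComplex V} (φ : SimplicialMap L K)
    (x : Realization L) : Realization K :=
  have hsum : ((x.coord.mapDomain φ.toFun).sum fun _ a => a) = 1 := by
    rw [Finsupp.sum_mapDomain_index (fun _ => rfl) (fun _ _ _ => rfl)]
    exact x.sum_eq_one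
  { coord := x.coord.mapDomain φ.toFun
    nonneg := fun v => by
      classical
      rw [Finsupp.mapDomain, Finsupp.sum_apply]
      refine Finset.sum_nonneg fun a _ => ?_
      simp only [Finsupp.single_apply]
      split_ifs
      · exact x.nonneg a
      · exact le_rfl
    sum_eq_one := hsum
    support_mem := by
      classical
      refine (K.isRelLowerSet_faces (φ.image_mem _ x.support_mem)).2 ?_ ?_
      · convert Finsupp.mapDomain_support (f := φ.toFun) (s := x.coord)
      · rw [Finset.nonempty_iff_ne_empty]
        intro h
        rw [Finsupp.support_eq_empty] at h
        rw [h, Finsupp.sum_zero_index] at hsum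
        exact zero_ne_one hsum }

/-! ### The order complex functor -/

/-- The order complex `K(X)`: its simplices are the non-empty finite chains of `X`. The order of an
A-space `X` is `x ≤ y` iff `x` lies in every open set containing `y`, i.e. iff `x ⤳ y`; it is a
partial order if and only if `X` is T₀. -/
def orderComplex (X : Type u) [TopologicalSpace X] : AbstractSimplicialComplex X where
  faces := {s | s.Nonempty ∧ IsChain (fun x y : X => x ⤳ y) (s : Set X)}
  isRelLowerSet_faces := fun _ hs =>
    ⟨hs.1, fun _ hts ht => ⟨ht, hs.2.mono (Finset.coe_subset.2 hts)⟩⟩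
  singleton_mem v := ⟨Finset.singleton_nonempty v, by simp⟩

/-- The simplicial map `K(f) : K(X) → K(Y)` induced by a continuous map `f`. -/
def orderComplexMap {X : Type v} {Y : Type u} [TopologicalSpace X] [TopologicalSpace Y]
    (f : C(X, Y)) : SimplicialMap (orderComplex X) (orderComplex Y) where
  toFun := f
  image_mem s hs := by
    classical
    refine ⟨hs.1.image _, ?_⟩
    rw [Finset.coe_image]
    rintro _ ⟨a, ha, rfl⟩ _ ⟨b, hb, rfl⟩ hab
    have hne : a ≠ b := fun h => hab (congrArg f h)
    exact (hs.2 ha hb hne).imp (fun h => h.map f.continuous) (fun h => h.map f.continuous)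

/-! ### The face poset functor -/

/-- The face poset of `K`: the simplices of `K` ordered by inclusion. -/
@[ext]
structure FacePoset {V : Type u} (K : AbstractSimplicialComplex V) : Type u where
  /-- The set of vertices of the simplex. -/
  simplex : Finset V
  mem : simplex ∈ K

instance {V : Type u} (K : AbstractSimplicialComplex V) : PartialOrder (FacePoset K) :=
  PartialOrder.lift FacePoset.simplex fun _ _ => FacePoset.ext

/-- The topology with the sets `{τ | τ ≤ σ}` as a basis; its open sets are the lower sets. -/
instance {V : Type u} (K : AbstractSimplicialComplex V) : TopologicalSpace (FacePoset K) :=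
  Topology.lowerSet (FacePoset K)

open Classical in
/-- The map of face posets induced by a simplicial map, `σ ↦ φ(σ)`. -/
noncomputable def SimplicialMap.facePoset {W : Type v} {V : Type u}
    {L : AbstractSimplicialComplex W} {K : AbstractSimplicialComplex V} (φ : SimplicialMap L K)
    (s : FacePoset L) : FacePoset K :=
  ⟨s.simplex.image φ.toFun, φ.image_mem s.simplex s.mem⟩

end PosetCov

open PosetCov

/-!
Coverings of `|K|`, of the face poset of `K` and, for `K` the order complex of `B`, of `B` itself
are all compared with one combinatorial notion: a simplicial map `φ : L → K` is a combinatorial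
covering if through every vertex of `L` each simplex of `K` at its image lifts uniquely.

A combinatorial covering realizes to a covering, the sheets over an open star being open stars.
Conversely, simplices are simply connected, so a covering of `|K|` lifts every simplex uniquely
through each point over it; the lifted simplices form a complex `L`, and the covering is
`|L| → |K|`.

A covering of an A-space `B` is a monotone map for which the points below and above a given point
lift uniquely. In the face poset of `K`, an element is determined by the vertices below it, so its
coverings are again the combinatorial coverings of `K`. In the order complex of `B`, comparable
points span an edge, so a combinatorial covering of it with vertices `W` orders `W` by lifting the
order of `B` along edges. In each case a map over the base is determined by its effect on vertices,
hence equivalence of coverings means isomorphism of combinatorial coverings.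
-/

namespace PosetCov

open Topology Function Set

/-! ### Coverings -/

theorem CoveringClass.mk_eq_mk_iff {B : Type u} [TopologicalSpace B] {E E' : Type v}
    [TopologicalSpace E] [TopologicalSpace E'] {p : E → B} {p' : E' → B} (hp : IsCovering p)
    (hp' : IsCovering p') :
    CoveringClass.mk p hp = CoveringClass.mk p' hp' ↔ ∃ h : E ≃ₜ E', ∀ e, p' (h e) = p e :=
  Quotient.eq

theorem CoveringClass.exists_mk_eq {B : Type u} [TopologicalSpace B]
    (c : CoveringClass.{u, v} B) :
    ∃ (E : Type v) (_ : TopologicalSpace E) (p : E → B) (hp : IsCovering p),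
      CoveringClass.mk p hp = c := by
  induction c using Quotient.ind with
  | _ c => exact ⟨c.total, c.top, c.proj, c.isCovering, rfl⟩

theorem exists_bijective_comp_eq {S A B : Type*} {a : S → A} {b : S → B} (ha : Surjective a)
    (hb : Surjective b) (hab : ∀ s s', a s = a s' ↔ b s = b s') :
    ∃ Φ : A → B, Bijective Φ ∧ ∀ s, Φ (a s) = b s := by
  have apply_eq (s : S) : b (surjInv ha (a s)) = b s := (hab _ _).1 (surjInv_eq ha (a s))
  refine ⟨b ∘ surjInv ha, ⟨fun x y hxy => ?_, fun y => ?_⟩, apply_eq⟩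
  · rw [← surjInv_eq ha x, ← surjInv_eq ha y]
    exact (hab _ _).2 hxy
  · obtain ⟨s, rfl⟩ := hb y
    exact ⟨a s, apply_eq s⟩

section Covering

variable {E B : Type*} [TopologicalSpace E] [TopologicalSpace B] {p : E → B}

theorem IsCovering.continuous (hp : IsCovering p) : Continuous p := hp.1.continuous

theorem IsCovering.exists_injOn (hp : IsCovering p) (e : E) :
    ∃ U : Set E, IsOpen U ∧ e ∈ U ∧ U.InjOn p := by
  obtain ⟨f, hf, rfl⟩ := hp.1.isLocalHomeomorph e
  exact ⟨f.source, f.open_source, hf, f.injOn⟩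

theorem isCovering_of_sheets (hc : Continuous p) (ho : IsOpenMap p) (hs : Surjective p)
    (h : ∀ b, ∃ V : Set B, IsOpen V ∧ b ∈ V ∧ ∃ (ι : Type*) (U : ι → Set E),
      (∀ i, IsOpen (U i)) ∧ (∀ i, (U i).InjOn p) ∧ (∀ i, (U i).SurjOn p V) ∧
      Pairwise (Disjoint on U) ∧ p ⁻¹' V ⊆ ⋃ i, U i) :
    IsCovering p := by
  refine ⟨fun b => ?_, hs⟩
  obtain ⟨V, hV, hb, ι, U, hU, inj, surj, disj, exh⟩ := h b
  obtain ⟨e, rfl⟩ := hs b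
  obtain ⟨i, -⟩ := mem_iUnion.1 (exh hb)
  have : Nonempty ι := ⟨i⟩
  have : Nonempty (B → E) := ⟨fun _ => e⟩
  let _ : TopologicalSpace ι := ⊥
  have : DiscreteTopology ι := ⟨rfl⟩
  have isOpen_iff (i : ι) {W : Set B} (hW : W ⊆ V) : IsOpen W ↔ IsOpen (p ⁻¹' W ∩ U i) := by
    refine ⟨fun hWo => (hWo.preimage hc).inter (hU i), fun hWo => ?_⟩
    rw [← inter_eq_left.2 (hW.trans (surj i)), ← image_preimage_inter]
    exact ho _ hWo
  exact IsEvenlyCovered.to_isEvenlyCovered_preimage (I := ι) (.of_trivialization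
    (t := hV.trivializationDiscrete U V (fun i _ => isOpen_iff i) inj surj disj exh) hb)

theorem IsCovering.eq_of_lifts (hp : IsCovering p) {A : Type*} [TopologicalSpace A]
    [PreconnectedSpace A] {F F' : A → E} (hF : Continuous F) (hF' : Continuous F')
    (h : ∀ a, p (F a) = p (F' a)) {a : A} (ha : F a = F' a) : F = F' :=
  hp.1.eq_of_comp_eq hF hF' (funext h) a ha

theorem IsCovering.exists_lift (hp : IsCovering p) {A : Type*} [TopologicalSpace A]
    [SimplyConnectedSpace A] [LocallyPathConnectedSpace A] {f : A → B} (hf : Continuous f)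
    {a : A} {e : E} (he : p e = f a) :
    ∃ F : A → E, Continuous F ∧ (∀ b, p (F b) = f b) ∧ F a = e := by
  obtain ⟨F, ⟨hFa, hF⟩, -⟩ := hp.1.existsUnique_continuousMap_lifts ⟨f, hf⟩ a e he
  exact ⟨F, F.continuous, congrFun hF, hFa⟩

end Covering

/-! ### Coverings of A-spaces -/

section Alexandrov

variable {X Y : Type*} [TopologicalSpace X] [TopologicalSpace Y]

theorem continuous_of_specializes [AlexandrovDiscrete X] {f : X → Y}
    (h : ∀ x y, x ⤳ y → f x ⤳ f y) : Continuous f :=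
  continuous_def.2 fun _ hU => isOpen_iff_forall_specializes.2 fun x y hxy hy =>
    (h x y hxy).mem_open hU hy

theorem exists_homeomorph_of_specializes_iff [AlexandrovDiscrete X] [AlexandrovDiscrete Y]
    (e : X ≃ Y) (h : ∀ x y, e x ⤳ e y ↔ x ⤳ y) : ∃ h : X ≃ₜ Y, ⇑h = e :=
  ⟨{ e with
      continuous_toFun := continuous_of_specializes fun x y => (h x y).2
      continuous_invFun := continuous_of_specializes fun x y hxy =>
        (h _ _).1 (by simpa using hxy) }, rfl⟩

theorem exists_alexandrovDiscrete_specializes_iff {X : Type*} {r : X → X → Prop}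
    (hrefl : ∀ x, r x x) (htrans : ∀ x y z, r x y → r y z → r x z) :
    ∃ _ : TopologicalSpace X, AlexandrovDiscrete X ∧ ∀ x y : X, x ⤳ y ↔ r x y := by
  let _ : Preorder X := { le := r, le_refl := hrefl, le_trans := htrans }
  let _ : TopologicalSpace X := lowerSet X
  have : Topology.IsLowerSet X := ⟨rfl⟩
  exact ⟨_, inferInstance, fun _ _ => Topology.IsLowerSet.specializes_iff_le⟩

variable {E B : Type*} [TopologicalSpace E] [TopologicalSpace B] {p : E → B}

theorem IsCovering.alexandrovDiscrete [AlexandrovDiscrete B] (hp : IsCovering p) :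
    AlexandrovDiscrete E := by
  refine ⟨fun S hS => isOpen_iff_mem_nhds.2 fun e he => ?_⟩
  obtain ⟨U, hU, heU, inj⟩ := hp.exists_injOn e
  have hN : IsOpen (U ∩ p ⁻¹' nhdsKer {p e}) := hU.inter (isOpen_nhdsKer.preimage hp.continuous)
  refine Filter.mem_of_superset (hN.mem_nhds ⟨heU, subset_nhdsKer rfl⟩) ?_
  rintro x ⟨hxU, hx⟩ s hs
  have nhdsKer_subset : nhdsKer {p e} ⊆ p '' (U ∩ s) :=
    nhdsKer_minimal (singleton_subset_iff.2 ⟨e, ⟨heU, he s hs⟩, rfl⟩)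
      (hp.1.isOpenMap _ (hU.inter (hS s hs)))
  obtain ⟨y, ⟨hyU, hys⟩, hyx⟩ := nhdsKer_subset hx
  rwa [← inj hyU hxU hyx]

theorem IsCovering.t0Space [T0Space B] (hp : IsCovering p) : T0Space E := by
  refine ⟨fun e e' h => ?_⟩
  obtain ⟨U, hU, heU, inj⟩ := hp.exists_injOn e
  exact inj heU ((h.mem_open_iff hU).1 heU) (h.map hp.continuous).eq

theorem IsCovering.exists_lift_below [AlexandrovDiscrete B] (hp : IsCovering p) {e : E} {b : B}
    (hb : b ⤳ p e) : ∃ e', e' ⤳ e ∧ p e' = b := by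
  have := hp.alexandrovDiscrete
  have ho : IsOpen (p '' nhdsKer {e}) := hp.1.isOpenMap _ isOpen_nhdsKer
  obtain ⟨e', he', rfl⟩ := hb.mem_open ho ⟨e, subset_nhdsKer rfl, rfl⟩
  exact ⟨e', mem_nhdsKer_singleton.1 he', rfl⟩

theorem IsCovering.eq_of_below (hp : IsCovering p) {e x y : E} (hx : x ⤳ e) (hy : y ⤳ e)
    (hxy : p x = p y) : x = y := by
  obtain ⟨U, hU, heU, inj⟩ := hp.exists_injOn e
  exact inj (hx.mem_open hU heU) (hy.mem_open hU heU) hxy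

theorem IsCovering.eq_of_specializes (hp : IsCovering p) {x y : E} (h : x ⤳ y)
    (hxy : p x = p y) : x = y :=
  hp.eq_of_below h specializes_rfl hxy

theorem IsCovering.exists_lift_above (hp : IsCovering p) {e : E} {b : B}
    (hb : p e ⤳ b) : ∃ e', e ⤳ e' ∧ p e' = b := by
  obtain ⟨-, V, hbV, hV, -, H, hH⟩ := hp.1 b
  let x : p ⁻¹' V := ⟨e, hb.mem_open hV hbV⟩
  let y : p ⁻¹' V := H.symm (⟨b, hbV⟩, (H x).2)
  have hxy : H x ⤳ (⟨b, hbV⟩, (H x).2) := by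
    refine Specializes.prod (x₁ := (H x).1) (y₁ := (H x).2) ?_ specializes_rfl
    rwa [subtype_specializes_iff, hH]
  refine ⟨y, ?_, ?_⟩
  · have := hxy.map H.symm.continuous
    rw [H.symm_apply_apply] at this
    exact this.map continuous_subtype_val
  · rw [← hH, H.apply_symm_apply]

theorem IsCovering.eq_of_above (hp : IsCovering p) {e x y : E} (hx : e ⤳ x) (hy : e ⤳ y)
    (hxy : p x = p y) : x = y := by
  by_contra hne
  obtain ⟨U, V, hU, hV, hxU, hyV, hUV⟩ := hp.1.isSeparatedMap x y hxy hne
  exact disjoint_left.1 hUV (hx.mem_open hU hxU) (hy.mem_open hV hyV)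

/-- The sheets over the least neighbourhood of `b` are the least neighbourhoods of the points
over `b`. -/
theorem isCovering_of_lifts [AlexandrovDiscrete E] [AlexandrovDiscrete B]
    (hmono : ∀ x y, x ⤳ y → p x ⤳ p y) (hs : Surjective p)
    (exists_below : ∀ e b, b ⤳ p e → ∃ e', e' ⤳ e ∧ p e' = b)
    (eq_of_below : ∀ e x y, x ⤳ e → y ⤳ e → p x = p y → x = y)
    (exists_above : ∀ e b, p e ⤳ b → ∃ e', e ⤳ e' ∧ p e' = b)
    (eq_of_above : ∀ e x y, e ⤳ x → e ⤳ y → p x = p y → x = y) : IsCovering p := by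
  refine isCovering_of_sheets (continuous_of_specializes hmono) ?_ hs fun b =>
    ⟨nhdsKer {b}, isOpen_nhdsKer, subset_nhdsKer rfl, p ⁻¹' {b}, fun e => nhdsKer {e.1},
      fun _ => isOpen_nhdsKer, ?_, ?_, ?_, ?_⟩
  · refine fun U hU => isOpen_iff_forall_specializes.2 ?_
    rintro x _ hx ⟨e, he, rfl⟩
    obtain ⟨e', he', rfl⟩ := exists_below e x hx
    exact ⟨e', he'.mem_open hU he, rfl⟩
  · intro e x hx y hy hxy
    exact eq_of_below e x y (mem_nhdsKer_singleton.1 hx) (mem_nhdsKer_singleton.1 hy) hxy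
  · rintro ⟨e, rfl⟩ x hx
    obtain ⟨e', he', rfl⟩ := exists_below e x (mem_nhdsKer_singleton.1 hx)
    exact ⟨e', mem_nhdsKer_singleton.2 he', rfl⟩
  · rintro ⟨e, he⟩ ⟨e', he'⟩ hne
    refine disjoint_left.2 fun x hx hx' => hne (Subtype.ext ?_)
    exact eq_of_above x e e' (mem_nhdsKer_singleton.1 hx) (mem_nhdsKer_singleton.1 hx')
      (he.trans he'.symm)
  · intro x hx
    obtain ⟨e, he, rfl⟩ := exists_above x b (mem_nhdsKer_singleton.1 hx)
    exact mem_iUnion.2 ⟨⟨e, rfl⟩, mem_nhdsKer_singleton.2 he⟩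

end Alexandrov

/-! ### Faces of simplicial complexes -/

section Faces

variable {V W : Type*} {K : AbstractSimplicialComplex V} {L : AbstractSimplicialComplex W}

/-- The vertices in `A` lie in a common simplex of `K`; unlike a simplex, `A` may be empty. -/
def InFace (K : AbstractSimplicialComplex V) (A : Set V) : Prop :=
  ∃ s ∈ K, A ⊆ (s : Set V)

theorem nonempty_of_mem {s : Finset V} (hs : s ∈ K) : s.Nonempty :=
  (K.isRelLowerSet_faces hs).1

theorem InFace.mono {A A' : Set V} (h : InFace K A') (hA : A ⊆ A') : InFace K A :=
  let ⟨s, hs, hAs⟩ := h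
  ⟨s, hs, hA.trans hAs⟩

theorem inFace_coe {s : Finset V} (hs : s ∈ K) : InFace K (s : Set V) := ⟨s, hs, Subset.rfl⟩

theorem InFace.mem {t : Finset V} (h : InFace K (t : Set V)) (ht : t.Nonempty) : t ∈ K :=
  let ⟨_, hs, hts⟩ := h
  (K.isRelLowerSet_faces hs).2 (Finset.coe_subset.1 hts) ht

theorem inFace_singleton (v : V) : InFace K {v} := ⟨{v}, K.singleton_mem v, by simp⟩

theorem inFace_pair {s : Finset V} (hs : s ∈ K) {v v' : V} (hv : v ∈ s) (hv' : v' ∈ s) :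
    InFace K {v, v'} :=
  ⟨s, hs, pair_subset hv hv'⟩

theorem inFace_range_val {s : Finset V} (hs : s ∈ K) :
    InFace K (range (Subtype.val : s → V)) :=
  ⟨s, hs, by simp⟩

theorem SimplicialMap.inFace_image (φ : SimplicialMap L K) {A : Set W} (h : InFace L A) :
    InFace K (φ.toFun '' A) := by
  classical
  obtain ⟨s, hs, hA⟩ := h
  refine ⟨_, φ.image_mem s hs, ?_⟩
  rw [Finset.coe_image]
  exact image_mono hA

theorem SimplicialMap.inFace_range_comp (φ : SimplicialMap L K) {T : Type*} {f : T → W}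
    (h : InFace L (range f)) : InFace K (range (φ.toFun ∘ f)) := by
  rw [range_comp]
  exact φ.inFace_image h

theorem SimplicialMap.exists_image (φ : SimplicialMap L K) {t : Finset W} (ht : t ∈ L) :
    ∃ s ∈ K, (s : Set V) = φ.toFun '' t := by
  classical
  exact ⟨_, φ.image_mem t ht, Finset.coe_image⟩

/-- The simplicial map with the given map of vertices. -/
def SimplicialMap.ofInFace (f : W → V) (h : ∀ t ∈ L, InFace K (f '' t)) : SimplicialMap L K where
  toFun := f
  image_mem t ht := by
    classical
    refine InFace.mem ?_ ((nonempty_of_mem ht).image f)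
    rw [Finset.coe_image]
    exact h t ht

end Faces

/-! ### Affine simplices of the geometric realization -/

section StdSimplex

variable {T : Type*} [Fintype T]

instance : LocallyPathConnectedSpace (stdSimplex ℝ T) :=
  (convex_stdSimplex ℝ T).locallyPathConnectedSpace

instance : PreconnectedSpace (stdSimplex ℝ T) :=
  Subtype.preconnectedSpace (convex_stdSimplex ℝ T).isPreconnected

instance [Nonempty T] : SimplyConnectedSpace (stdSimplex ℝ T) := by
  classical
  have := (convex_stdSimplex ℝ T).contractibleSpace
    ⟨_, single_mem_stdSimplex ℝ (Classical.arbitrary T)⟩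
  exact inferInstance

theorem dense_setOf_forall_ne_zero : Dense {a : stdSimplex ℝ T | ∀ i, a i ≠ 0} := by
  intro a
  cases isEmpty_or_nonempty T with
  | inl _ => exact subset_closure isEmptyElim
  | inr _ =>
    let b : stdSimplex ℝ T := stdSimplex.barycenter
    let γ : unitInterval → stdSimplex ℝ T := fun ε =>
      ⟨AffineMap.lineMap a.1 b.1 ε.1, (convex_stdSimplex ℝ T).lineMap_mem a.2 b.2 ε.2⟩
    have continuous_γ : Continuous γ :=
      (AffineMap.lineMap_continuous.comp continuous_subtype_val).subtype_mk _
    have zero_mem : (0 : unitInterval) ∈ closure (Ioi 0) := by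
      rw [closure_Ioi' ⟨1, zero_lt_one⟩]
      exact self_mem_Ici
    have γ_ne_zero : MapsTo γ (Ioi 0) {a : stdSimplex ℝ T | ∀ i, a i ≠ 0} := by
      intro ε hε i
      have : AffineMap.lineMap a.1 b.1 ε.1 i = (1 - ε.1) * a i + ε.1 * (Fintype.card T : ℝ)⁻¹ := by
        rw [AffineMap.lineMap_apply_module]
        rfl
      have hb : 0 < ε.1 * (Fintype.card T : ℝ)⁻¹ := mul_pos hε (by positivity)
      have ha : 0 ≤ (1 - ε.1) * a i :=
        mul_nonneg (sub_nonneg.2 ε.2.2) (stdSimplex.zero_le a i)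
      exact (this ▸ add_pos_of_nonneg_of_pos ha hb).ne'
    have γ_zero : γ 0 = a := Subtype.ext (AffineMap.lineMap_apply_zero _ _)
    exact γ_zero ▸ map_mem_closure continuous_γ zero_mem γ_ne_zero

end StdSimplex

section AffineSimplex

variable {V W S T : Type*} [Fintype S] [Fintype T] {K : AbstractSimplicialComplex V}
  {L : AbstractSimplicialComplex W}

theorem mapDomain_equivFunOnFinite_symm_apply [DecidableEq V] (f : T → V) (a : T → ℝ) (v : V) :
    (Finsupp.equivFunOnFinite.symm a).mapDomain f v = ∑ i with f i = v, a i := by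
  rw [Finsupp.equivFunOnFinite_symm_eq_sum, Finsupp.mapDomain_finsetSum, Finsupp.finsetSum_apply]
  simp only [Finsupp.mapDomain_single, Finsupp.single_apply, Finset.sum_filter]

/-- The affine simplex of `|K|` with the vertices `f i`, which span a simplex of `K` but need not
be distinct, as a function of the barycentric coordinates. -/
noncomputable def affineSimplex (f : T → V) (hf : InFace K (range f)) (a : stdSimplex ℝ T) :
    Realization K :=
  have hsum : (((Finsupp.equivFunOnFinite.symm a).mapDomain f).sum fun _ r => r) = 1 := by
    rw [Finsupp.sum_mapDomain_index (fun _ => rfl) (fun _ _ _ => rfl),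
      Finsupp.sum_fintype _ _ (fun _ => rfl)]
    exact stdSimplex.sum_eq_one a
  { coord := (Finsupp.equivFunOnFinite.symm a).mapDomain f
    nonneg v := by
      classical
      rw [mapDomain_equivFunOnFinite_symm_apply]
      exact Finset.sum_nonneg fun i _ => stdSimplex.zero_le a i
    sum_eq_one := hsum
    support_mem := by
      classical
      refine (hf.mono ?_).mem ?_
      · intro v hv
        obtain ⟨i, -, hi⟩ := Finset.mem_image.1 (Finsupp.mapDomain_support hv)
        exact ⟨i, hi⟩
      · rw [Finsupp.support_nonempty_iff]
        intro h
        rw [h, Finsupp.sum_zero_index] at hsum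
        exact zero_ne_one hsum }

theorem Realization.ext_coord {x y : Realization K} (h : ∀ v, x.coord v = y.coord v) : x = y :=
  Realization.ext (Finsupp.ext h)

theorem coord_affineSimplex [DecidableEq V] (f : T → V) (hf : InFace K (range f))
    (a : stdSimplex ℝ T) (v : V) : (affineSimplex f hf a).coord v = ∑ i with f i = v, a i :=
  mapDomain_equivFunOnFinite_symm_apply f a v

theorem coord_affineSimplex_apply {f : T → V} (hf : InFace K (range f)) (hinj : Injective f)
    (a : stdSimplex ℝ T) (i : T) : (affineSimplex f hf a).coord (f i) = a i :=
  Finsupp.mapDomain_apply hinj _ i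

theorem affineSimplex_injective {f : T → V} (hf : InFace K (range f)) (hinj : Injective f) :
    Injective (affineSimplex f hf) := fun a b h => by
  ext i
  rw [← coord_affineSimplex_apply hf hinj a, h, coord_affineSimplex_apply hf hinj]

theorem support_affineSimplex (f : T → V) (hf : InFace K (range f)) (a : stdSimplex ℝ T) :
    ((affineSimplex f hf a).coord.support : Set V) = f '' {i | a i ≠ 0} := by
  classical
  ext v
  rw [Finset.mem_coe, Finsupp.mem_support_iff, coord_affineSimplex, Ne,
    Finset.sum_eq_zero_iff_of_nonneg fun i _ => stdSimplex.zero_le a i]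
  simp only [Finset.mem_filter_univ, not_forall, mem_image, mem_ofPred_eq, exists_prop, and_comm]

theorem affineSimplex_map (g : S → T) (f : T → V) (hf : InFace K (range f))
    (a : stdSimplex ℝ S) :
    affineSimplex f hf (stdSimplex.map g a) =
      affineSimplex (f ∘ g) (hf.mono (range_comp_subset_range g f)) a := by
  refine Realization.ext ?_
  simp only [affineSimplex, Finsupp.mapDomain_comp]
  congr 1
  exact Equiv.symm_apply_apply _ _

theorem SimplicialMap.realization_affineSimplex (φ : SimplicialMap L K) (f : T → W)
    (hf : InFace L (range f)) (a : stdSimplex ℝ T) :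
    φ.realization (affineSimplex f hf a) =
      affineSimplex (φ.toFun ∘ f) (φ.inFace_range_comp hf) a :=
  Realization.ext Finsupp.mapDomain_comp.symm

theorem Realization.exists_affineSimplex_eq (x : Realization K) (f : T → V)
    (hf : InFace K (range f)) (hx : (x.coord.support : Set V) ⊆ range f) :
    ∃ a, affineSimplex f hf a = x := by
  choose g hg using fun v : x.coord.support => hx v.2
  let a : stdSimplex ℝ x.coord.support := ⟨fun v => x.coord v, fun v => x.nonneg v, by
    rw [Finset.sum_coe_sort x.coord.support x.coord]
    exact x.sum_eq_one⟩
  refine ⟨stdSimplex.map g a, ?_⟩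
  have hfg : f ∘ g = Subtype.val := funext hg
  rw [affineSimplex_map]
  simp only [hfg]
  refine Realization.ext_coord fun v => ?_
  by_cases hv : v ∈ x.coord.support
  · exact coord_affineSimplex_apply (inFace_range_val x.support_mem) Subtype.val_injective a ⟨v, hv⟩
  · rw [Finsupp.notMem_support_iff.1 hv, ← Finsupp.notMem_support_iff, ← Finset.mem_coe,
      support_affineSimplex]
    rintro ⟨i, -, rfl⟩
    exact hv i.2

theorem Realization.exists_affineSimplex_val_eq (x : Realization K) {s : Finset V} (hs : s ∈ K)
    (hx : x.coord.support ⊆ s) : ∃ a, affineSimplex Subtype.val (inFace_range_val hs) a = x :=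
  x.exists_affineSimplex_eq _ _ (by simpa using hx)

theorem SimplicialMap.support_realization (φ : SimplicialMap L K) (x : Realization L) :
    ((φ.realization x).coord.support : Set V) = φ.toFun '' x.coord.support := by
  obtain ⟨a, ha⟩ := x.exists_affineSimplex_val_eq x.support_mem Subset.rfl
  rw [← ha, φ.realization_affineSimplex, support_affineSimplex, support_affineSimplex, image_comp]

end AffineSimplex

section Vertex

variable {V W T : Type*} [Fintype T] {K : AbstractSimplicialComplex V}
  {L : AbstractSimplicialComplex W}

/-- The vertex `v` as a point of `|K|`. -/
noncomputable def vertexPoint (K : AbstractSimplicialComplex V) (v : V) : Realization K where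
  coord := Finsupp.single v 1
  nonneg _ := Finsupp.single_nonneg.2 zero_le_one _
  sum_eq_one := Finsupp.sum_single_index rfl
  support_mem := by
    rw [Finsupp.support_single v one_ne_zero]
    exact K.singleton_mem v

theorem support_vertexPoint (v : V) : (vertexPoint K v).coord.support = {v} :=
  Finsupp.support_single v one_ne_zero

theorem vertexPoint_injective : Injective (vertexPoint K) := fun v v' h => by
  rw [← Finset.singleton_inj, ← support_vertexPoint (K := K), h, support_vertexPoint]

theorem affineSimplex_vertex [DecidableEq T] (f : T → V) (hf : InFace K (range f)) (i : T) :
    affineSimplex f hf (stdSimplex.vertex i) = vertexPoint K (f i) :=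
  Realization.ext <| by
    change (Finsupp.equivFunOnFinite.symm (Pi.single i 1)).mapDomain f = Finsupp.single (f i) 1
    rw [Finsupp.equivFunOnFinite_symm_single, Finsupp.mapDomain_single]

theorem Realization.eq_vertexPoint {x : Realization K} {v : V} (hx : x.coord.support ⊆ {v}) :
    x = vertexPoint K v := by
  have coord_eq : x.coord = Finsupp.single v (x.coord v) := Finsupp.support_subset_singleton.1 hx
  have hsum := x.sum_eq_one
  rw [coord_eq, Finsupp.sum_single_index rfl] at hsum
  exact Realization.ext (by rw [coord_eq, hsum, vertexPoint])

theorem SimplicialMap.realization_vertexPoint (φ : SimplicialMap L K) (w : W) :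
    φ.realization (vertexPoint L w) = vertexPoint K (φ.toFun w) :=
  Realization.ext Finsupp.mapDomain_single

end Vertex

/-! ### The coherent topology -/

section Topology

variable {V W T : Type*} [Fintype T] {K : AbstractSimplicialComplex V}
  {L : AbstractSimplicialComplex W}

theorem continuous_coord_affineSimplex (f : T → V) (hf : InFace K (range f)) (v : V) :
    Continuous fun a => (affineSimplex f hf a).coord v := by
  classical
  simp only [coord_affineSimplex]
  exact continuous_finsetSum _ fun i _ => (continuous_apply i).comp continuous_subtype_val

theorem continuous_affineSimplex (f : T → V) (hf : InFace K (range f)) :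
    Continuous (affineSimplex f hf) := by
  have ⟨s, hs, hfs⟩ := hf
  refine continuous_def.2 fun U hU => ?_
  obtain ⟨O, hO, hOU⟩ := (realization_isOpen_iff K U).1 hU s hs
  convert hO.preimage (continuous_pi (continuous_coord_affineSimplex f hf))
  ext a
  exact (hOU _ (Finset.coe_subset.1
    ((support_affineSimplex f hf a).subset.trans ((image_subset_range f _).trans hfs)))).symm

namespace Realization

theorem isOpen_iff {U : Set (Realization K)} :
    IsOpen U ↔ ∀ s (hs : s ∈ K),
      IsOpen (affineSimplex Subtype.val (inFace_range_val hs) ⁻¹' U) := by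
  refine ⟨fun hU s hs => hU.preimage (continuous_affineSimplex _ _), fun h => ?_⟩
  refine (realization_isOpen_iff K U).2 fun s hs => ?_
  obtain ⟨O, hO, hOU⟩ := isOpen_induced_iff.1 (h s hs)
  refine ⟨(fun c (i : s) => c i) ⁻¹' O, hO.preimage (by fun_prop), fun x hx => ?_⟩
  obtain ⟨a, rfl⟩ := x.exists_affineSimplex_val_eq hs hx
  rw [← mem_preimage (s := U), ← hOU, mem_preimage, mem_preimage]
  simp only [coord_affineSimplex_apply _ Subtype.val_injective]
  rfl

theorem continuous_iff {X : Type*} [TopologicalSpace X] {g : Realization K → X} :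
    Continuous g ↔ ∀ s (hs : s ∈ K),
      Continuous fun a => g (affineSimplex Subtype.val (inFace_range_val hs) a) := by
  simp only [continuous_def, isOpen_iff]
  exact ⟨fun h s hs U hU => h U hU s hs, fun h U hU s hs => h s hs U hU⟩

theorem continuous_coord (v : V) : Continuous fun x : Realization K => x.coord v :=
  continuous_iff.2 fun _ _ => continuous_coord_affineSimplex _ _ v

/-- The open star of the vertex `v` in `|K|`. -/
def openStar (K : AbstractSimplicialComplex V) (v : V) : Set (Realization K) :=
  {x | v ∈ x.coord.support}

theorem isOpen_openStar (v : V) : IsOpen (openStar K v) := by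
  simp only [openStar, Finsupp.mem_support_iff]
  exact isOpen_ne.preimage (continuous_coord v)

theorem exists_mem_openStar (x : Realization K) : ∃ v, x ∈ openStar K v :=
  nonempty_of_mem x.support_mem

theorem vertexPoint_mem_openStar (v : V) : vertexPoint K v ∈ openStar K v := by
  rw [openStar, mem_ofPred_eq, support_vertexPoint]
  exact Finset.mem_singleton_self v

end Realization

theorem affineSimplex_mem_openStar {f : T → V} {hf : InFace K (range f)} {a : stdSimplex ℝ T}
    {v : V} : affineSimplex f hf a ∈ Realization.openStar K v ↔ ∃ i, a i ≠ 0 ∧ f i = v := by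
  rw [Realization.openStar, mem_ofPred_eq, ← Finset.mem_coe, support_affineSimplex]
  rfl

theorem SimplicialMap.realization_mem_openStar (φ : SimplicialMap L K) {y : Realization L}
    {v : V} : φ.realization y ∈ Realization.openStar K v ↔
      ∃ w, y ∈ Realization.openStar L w ∧ φ.toFun w = v := by
  rw [Realization.openStar, mem_ofPred_eq, ← Finset.mem_coe, φ.support_realization]
  rfl

theorem SimplicialMap.continuous_realization (φ : SimplicialMap L K) :
    Continuous φ.realization := by
  refine Realization.continuous_iff.2 fun s hs => ?_
  simp only [φ.realization_affineSimplex]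
  exact continuous_affineSimplex _ _

end Topology

/-! ### Combinatorial coverings -/

section CombCovering

variable {V W W' : Type*} {K : AbstractSimplicialComplex V} {L : AbstractSimplicialComplex W}
  {L' : AbstractSimplicialComplex W'} {φ : SimplicialMap L K} {φ' : SimplicialMap L' K}

/-- A combinatorial covering of simplicial complexes: every simplex of `K` has exactly one lift
through each vertex over one of its vertices. Uniqueness is required on edges only. -/
structure IsCombCovering (φ : SimplicialMap L K) : Prop where
  surjective : Surjective φ.toFun
  eq_of_inFace : ∀ {w x y}, InFace L {w, x} → InFace L {w, y} → φ.toFun x = φ.toFun y → x = y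
  exists_lift : ∀ w, ∀ s ∈ K, φ.toFun w ∈ s → ∃ t ∈ L, w ∈ t ∧ φ.toFun '' t = s

namespace IsCombCovering

theorem injOn (hφ : IsCombCovering φ) {A : Set W} (hA : InFace L A) : A.InjOn φ.toFun :=
  fun _ hx _ hy hxy =>
    hφ.eq_of_inFace (hA.mono (pair_subset hx hx)) (hA.mono (pair_subset hx hy)) hxy

theorem mem_of_inFace (hφ : IsCombCovering φ) {A : Set W} (hA : InFace L A) {w x : W} (hw : w ∈ A)
    (hx : InFace L {w, x}) (hxA : φ.toFun x ∈ φ.toFun '' A) : x ∈ A := by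
  obtain ⟨y, hy, hyx⟩ := hxA
  rwa [hφ.eq_of_inFace hx (hA.mono (pair_subset hw hy)) hyx.symm]

theorem exists_section (hφ : IsCombCovering φ) {s : Finset V} (hs : s ∈ K) {w : W}
    (hw : φ.toFun w ∈ s) :
    ∃ g : s → W, InFace L (range g) ∧ φ.toFun ∘ g = Subtype.val ∧ w ∈ range g := by
  obtain ⟨t, ht, hwt, hts⟩ := hφ.exists_lift w s hs hw
  choose g hgt hg using fun v : s => hts.superset v.2
  have hgL : InFace L (range g) := ⟨t, ht, range_subset_iff.2 hgt⟩
  exact ⟨g, hgL, funext hg, ⟨_, hw⟩, hφ.injOn (inFace_coe ht) (hgt _) hwt (hg _)⟩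

theorem realization_surjective (hφ : IsCombCovering φ) : Surjective φ.realization := fun x => by
  obtain ⟨v, hv⟩ := x.exists_mem_openStar
  obtain ⟨w, rfl⟩ := hφ.surjective v
  obtain ⟨g, hgL, hg, -⟩ := hφ.exists_section x.support_mem hv
  obtain ⟨a, ha⟩ := x.exists_affineSimplex_val_eq x.support_mem Subset.rfl
  exact ⟨affineSimplex g hgL a, by simp only [φ.realization_affineSimplex, hg, ha]⟩

theorem eq_affineSimplex (hφ : IsCombCovering φ) {s : Finset V} (hs : s ∈ K) {g : s → W}
    (hgL : InFace L (range g)) (hg : φ.toFun ∘ g = Subtype.val) {y : Realization L} {w : W}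
    (hw : w ∈ range g) (hy : y ∈ Realization.openStar L w) {a : stdSimplex ℝ s}
    (hya : φ.realization y = affineSimplex Subtype.val (inFace_range_val hs) a) :
    y = affineSimplex g hgL a := by
  have support_subset : (y.coord.support : Set W) ⊆ range g := fun x hx => by
    refine hφ.mem_of_inFace hgL hw (inFace_pair y.support_mem hy hx) ?_
    have hφx := φ.realization_mem_openStar.2 ⟨x, hx, rfl⟩
    rw [hya, affineSimplex_mem_openStar] at hφx
    obtain ⟨v, -, hv⟩ := hφx
    rw [← range_comp, hg]
    exact ⟨v, hv⟩
  obtain ⟨b, rfl⟩ := y.exists_affineSimplex_eq g hgL support_subset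
  simp only [φ.realization_affineSimplex, hg] at hya
  rw [affineSimplex_injective _ Subtype.val_injective hya]

theorem exists_eq_affineSimplex (hφ : IsCombCovering φ) {s : Finset V} (hs : s ∈ K)
    {y : Realization L} {a : stdSimplex ℝ s}
    (hya : φ.realization y = affineSimplex Subtype.val (inFace_range_val hs) a) :
    ∃ (g : s → W) (hgL : InFace L (range g)),
      φ.toFun ∘ g = Subtype.val ∧ y = affineSimplex g hgL a := by
  obtain ⟨w, hw⟩ := y.exists_mem_openStar
  have hφw := φ.realization_mem_openStar.2 ⟨w, hw, rfl⟩
  rw [hya, affineSimplex_mem_openStar] at hφw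
  obtain ⟨v, -, hv⟩ := hφw
  obtain ⟨g, hgL, hg, hwg⟩ := hφ.exists_section hs (hv ▸ v.2)
  exact ⟨g, hgL, hg, hφ.eq_affineSimplex hs hgL hg hwg hw hya⟩

theorem isOpenMap_realization (hφ : IsCombCovering φ) : IsOpenMap φ.realization := by
  refine fun U hU => Realization.isOpen_iff.2 fun s hs => isOpen_iff_forall_mem_open.2 ?_
  rintro a ⟨y, hyU, hya⟩
  obtain ⟨g, hgL, hg, rfl⟩ := hφ.exists_eq_affineSimplex hs hya
  refine ⟨affineSimplex g hgL ⁻¹' U, ?_, hU.preimage (continuous_affineSimplex g hgL), hyU⟩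
  exact fun b hb => ⟨_, hb, by simp only [φ.realization_affineSimplex, hg]⟩

theorem realization_surjOn_openStar (hφ : IsCombCovering φ) (w : W) :
    SurjOn φ.realization (Realization.openStar L w) (Realization.openStar K (φ.toFun w)) := by
  intro x hx
  obtain ⟨g, hgL, hg, v, rfl⟩ := hφ.exists_section x.support_mem hx
  obtain ⟨a, ha⟩ := x.exists_affineSimplex_val_eq x.support_mem Subset.rfl
  refine ⟨affineSimplex g hgL a, ?_, by simp only [φ.realization_affineSimplex, hg, ha]⟩
  obtain ⟨i, hi, hiv⟩ := affineSimplex_mem_openStar.1 (ha ▸ hx)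
  exact affineSimplex_mem_openStar.2
    ⟨i, hi, congrArg g (Subtype.ext (hiv.trans (congrFun hg v)))⟩

theorem realization_injOn_openStar (hφ : IsCombCovering φ) (w : W) :
    InjOn φ.realization (Realization.openStar L w) := by
  intro x hx y hy hxy
  have hs := (φ.realization y).support_mem
  obtain ⟨a, ha⟩ := (φ.realization y).exists_affineSimplex_val_eq hs Subset.rfl
  obtain ⟨g, hgL, hg, hwg⟩ :=
    hφ.exists_section hs (φ.realization_mem_openStar.2 ⟨w, hy, rfl⟩)
  exact (hφ.eq_affineSimplex hs hgL hg hwg hx (hxy.trans ha.symm)).trans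
    (hφ.eq_affineSimplex hs hgL hg hwg hy ha.symm).symm

/-- The sheets over the open star of `v` are the open stars of the vertices over `v`. -/
theorem isCovering (hφ : IsCombCovering φ) : IsCovering φ.realization := by
  refine isCovering_of_sheets φ.continuous_realization hφ.isOpenMap_realization
    hφ.realization_surjective fun x => ?_
  obtain ⟨v, hv⟩ := x.exists_mem_openStar
  refine ⟨Realization.openStar K v, Realization.isOpen_openStar v, hv, φ.toFun ⁻¹' {v},
    fun w => Realization.openStar L w, fun w => Realization.isOpen_openStar w.1,
    fun w => hφ.realization_injOn_openStar w.1, ?_, ?_, fun y hy => ?_⟩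
  · rintro ⟨w, rfl⟩
    exact hφ.realization_surjOn_openStar w
  · rintro ⟨w, hw⟩ ⟨w', hw'⟩ hne
    refine disjoint_left.2 fun y hy hy' => hne (Subtype.ext ?_)
    exact hφ.injOn (inFace_coe y.support_mem) hy hy' (hw.trans hw'.symm)
  · obtain ⟨w, hw, rfl⟩ := φ.realization_mem_openStar.1 hy
    exact mem_iUnion.2 ⟨⟨w, rfl⟩, hw⟩

end IsCombCovering

theorem SimplicialMap.surjective_of_realization (hφ : Surjective φ.realization) :
    Surjective φ.toFun := fun v => by
  obtain ⟨y, hy⟩ := hφ (vertexPoint K v)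
  have hv := Realization.vertexPoint_mem_openStar (K := K) v
  rw [← hy, φ.realization_mem_openStar] at hv
  exact hv.imp fun _ => And.right

theorem IsCovering.eq_of_inFace (hφ : IsCovering φ.realization) {w x y : W}
    (hx : InFace L {w, x}) (hy : InFace L {w, y}) (hxy : φ.toFun x = φ.toFun y) : x = y := by
  rw [← Matrix.range_cons_cons_empty w x ![]] at hx
  rw [← Matrix.range_cons_cons_empty w y ![]] at hy
  have hlabel : φ.toFun ∘ ![w, x] = φ.toFun ∘ ![w, y] := by
    ext i; fin_cases i <;> simp [hxy]
  have eq_lift : affineSimplex _ hx = affineSimplex _ hy :=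
    hφ.eq_of_lifts (continuous_affineSimplex _ _) (continuous_affineSimplex _ _)
      (fun a => by simp only [φ.realization_affineSimplex, hlabel]) (a := stdSimplex.vertex 0)
      (by simp only [affineSimplex_vertex, Matrix.cons_val_zero])
  have := congrFun eq_lift (stdSimplex.vertex 1)
  simpa only [affineSimplex_vertex, vertexPoint_injective.eq_iff, Matrix.cons_val_one,
    Matrix.cons_val_zero] using this

/-- The image of the open star of `w` is a neighbourhood of the vertex below `w`, so it contains
interior points of every simplex at that vertex. -/
theorem IsCovering.exists_simplex_lift (hφ : IsCovering φ.realization) (w : W) {s : Finset V}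
    (hs : s ∈ K) (hw : φ.toFun w ∈ s) : ∃ t ∈ L, w ∈ t ∧ φ.toFun '' t = s := by
  classical
  have isOpen_image := hφ.1.isOpenMap _ (Realization.isOpen_openStar (K := L) w)
  obtain ⟨a, ⟨y, hwy, hya⟩, ha⟩ := dense_setOf_forall_ne_zero.inter_open_nonempty _
    (isOpen_image.preimage (continuous_affineSimplex Subtype.val (inFace_range_val hs)))
    ⟨stdSimplex.vertex ⟨φ.toFun w, hw⟩, vertexPoint L w,
      Realization.vertexPoint_mem_openStar w, by
        rw [φ.realization_vertexPoint, affineSimplex_vertex]⟩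
  refine ⟨_, y.support_mem, hwy, ?_⟩
  have support_eq_univ : {i | a i ≠ 0} = univ := eq_univ_of_forall ha
  rw [← φ.support_realization, hya, support_affineSimplex, support_eq_univ, image_univ]
  exact Subtype.range_coe

theorem IsCovering.isCombCovering (hφ : IsCovering φ.realization) : IsCombCovering φ where
  surjective := SimplicialMap.surjective_of_realization hφ.2
  eq_of_inFace := hφ.eq_of_inFace
  exists_lift w _ hs hw := hφ.exists_simplex_lift w hs hw

/-! ### Morphisms of simplicial coverings -/

theorem IsCombCovering.exists_eq_vertexPoint (hφ : IsCombCovering φ) {y : Realization L} {v : V}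
    (hy : φ.realization y = vertexPoint K v) : ∃ w, y = vertexPoint L w ∧ φ.toFun w = v := by
  obtain ⟨w, hw⟩ := y.exists_mem_openStar
  have label_eq {x : W} (hx : x ∈ y.coord.support) : φ.toFun x = v := by
    have := φ.realization_mem_openStar.2 ⟨x, hx, rfl⟩
    rwa [hy, Realization.openStar, mem_ofPred_eq, support_vertexPoint,
      Finset.mem_singleton] at this
  refine ⟨w, Realization.eq_vertexPoint fun x hx => Finset.mem_singleton.2 ?_, label_eq hw⟩
  exact hφ.injOn (inFace_coe y.support_mem) hx hw ((label_eq hx).trans (label_eq hw).symm)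

/-- Simpliciality can be checked on edges, since a lift of a simplex through one of its vertices
is determined by its edges at that vertex. -/
theorem IsCombCovering.exists_simplicialMap (hφ' : IsCombCovering φ') {g : W → W'}
    (hg : ∀ w, φ'.toFun (g w) = φ.toFun w)
    (hedge : ∀ {w x}, InFace L {w, x} → InFace L' {g w, g x}) :
    ∃ ψ : SimplicialMap L L', ψ.toFun = g := by
  refine ⟨.ofInFace g fun t ht => ?_, rfl⟩
  obtain ⟨w, hw⟩ := nonempty_of_mem ht
  obtain ⟨s, hs, hst⟩ := φ.exists_image ht
  obtain ⟨t', ht', hwt', hts'⟩ :=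
    hφ'.exists_lift (g w) s hs (hst.superset ⟨w, hw, (hg w).symm⟩)
  refine (inFace_coe ht').mono ?_
  rintro _ ⟨x, hx, rfl⟩
  refine hφ'.mem_of_inFace (inFace_coe ht') hwt' (hedge (inFace_pair ht hw hx)) ?_
  rw [hts', hst, hg]
  exact mem_image_of_mem _ hx

theorem IsCombCovering.exists_edge_lift (hφ : IsCombCovering φ) {w : W} {v : V}
    (h : InFace K {φ.toFun w, v}) : ∃ x, InFace L {w, x} ∧ φ.toFun x = v := by
  obtain ⟨s, hs, hsv⟩ := h
  obtain ⟨t, ht, hwt, hts⟩ := hφ.exists_lift w s hs (hsv (mem_insert _ _))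
  obtain ⟨x, hx, rfl⟩ := hts.superset (hsv (mem_insert_of_mem _ rfl))
  exact ⟨x, inFace_pair ht hwt hx, rfl⟩

theorem IsCombCovering.exists_simplicialMap_of_realization (hφ' : IsCombCovering φ')
    {k : Realization L → Realization L'} (hk : Continuous k)
    (hkφ : ∀ x, φ'.realization (k x) = φ.realization x) :
    ∃ ψ : SimplicialMap L L', ∀ w, k (vertexPoint L w) = vertexPoint L' (ψ.toFun w) := by
  choose g hg hgφ using fun w => hφ'.exists_eq_vertexPoint
    ((hkφ (vertexPoint L w)).trans (φ.realization_vertexPoint w))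
  have map_edge {w x : W} (hwx : InFace L {w, x}) : InFace L' {g w, g x} := by
    have hφwx := φ.inFace_image hwx
    rw [image_pair, ← hgφ] at hφwx
    obtain ⟨y, hwy, hy⟩ := hφ'.exists_edge_lift hφwx
    have hgwy := hwy
    rw [← Matrix.range_cons_cons_empty _ _ ![]] at hwx hwy
    have hlabel : φ'.toFun ∘ ![g w, y] = φ.toFun ∘ ![w, x] := by
      ext i; fin_cases i <;> simp [hgφ, hy]
    have eq_lift : (fun a => k (affineSimplex _ hwx a)) = affineSimplex _ hwy :=
      hφ'.isCovering.eq_of_lifts (hk.comp (continuous_affineSimplex _ _))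
        (continuous_affineSimplex _ _) (a := stdSimplex.vertex 0)
        (fun a => by
          simp only [hkφ, φ.realization_affineSimplex, φ'.realization_affineSimplex, hlabel])
        (by simp only [affineSimplex_vertex, Matrix.cons_val_zero, hg])
    have hgx := congrFun eq_lift (stdSimplex.vertex 1)
    simp only [affineSimplex_vertex, hg, Matrix.cons_val_one, Matrix.cons_val_zero,
      vertexPoint_injective.eq_iff] at hgx
    rwa [hgx]
  obtain ⟨ψ, rfl⟩ := hφ'.exists_simplicialMap hgφ map_edge
  exact ⟨ψ, hg⟩

/-- An isomorphism of simplicial complexes over `K`: mutually inverse simplicial maps commuting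
with the maps to `K`. -/
def IsoOver (φ : SimplicialMap L K) (φ' : SimplicialMap L' K) : Prop :=
  ∃ (ψ : SimplicialMap L L') (ψ' : SimplicialMap L' L), LeftInverse ψ'.toFun ψ.toFun ∧
    RightInverse ψ'.toFun ψ.toFun ∧ ∀ w, φ'.toFun (ψ.toFun w) = φ.toFun w

theorem isoOver_of_edges (hφ : IsCombCovering φ) (hφ' : IsCombCovering φ') (e : W ≃ W')
    (he : ∀ w, φ'.toFun (e w) = φ.toFun w)
    (hedge : ∀ w x, InFace L {w, x} ↔ InFace L' {e w, e x}) : IsoOver φ φ' := by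
  obtain ⟨ψ, hψ⟩ := hφ'.exists_simplicialMap he fun {w x} => (hedge w x).1
  obtain ⟨ψ', hψ'⟩ := hφ.exists_simplicialMap (φ := φ') (g := e.symm)
    (fun w => by rw [← he, e.apply_symm_apply]) (fun {w x} h => by simpa [hedge] using h)
  refine ⟨ψ, ψ', ?_, ?_, ?_⟩ <;> simp only [hψ, hψ']
  exacts [e.left_inv, e.right_inv, he]

theorem SimplicialMap.realization_leftInverse {ψ : SimplicialMap L L'} {ψ' : SimplicialMap L' L}
    (h : LeftInverse ψ'.toFun ψ.toFun) : LeftInverse ψ'.realization ψ.realization := fun x =>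
  Realization.ext <| by
    change (x.coord.mapDomain ψ.toFun).mapDomain ψ'.toFun = x.coord
    rw [← Finsupp.mapDomain_comp, h.comp_eq_id, Finsupp.mapDomain_id]

theorem SimplicialMap.realization_realization {ψ : SimplicialMap L L'}
    (h : ∀ w, φ'.toFun (ψ.toFun w) = φ.toFun w) (x : Realization L) :
    φ'.realization (ψ.realization x) = φ.realization x :=
  Realization.ext <| by
    change (x.coord.mapDomain ψ.toFun).mapDomain φ'.toFun = x.coord.mapDomain φ.toFun
    rw [← Finsupp.mapDomain_comp, (funext h : φ'.toFun ∘ ψ.toFun = φ.toFun)]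

end CombCovering

theorem mk_realization_eq_iff {V : Type u} {W W' : Type v} {K : AbstractSimplicialComplex V}
    {L : AbstractSimplicialComplex W} {L' : AbstractSimplicialComplex W'} {φ : SimplicialMap L K}
    {φ' : SimplicialMap L' K} (hφ : IsCovering φ.realization) (hφ' : IsCovering φ'.realization) :
    CoveringClass.mk φ.realization hφ = CoveringClass.mk φ'.realization hφ' ↔ IsoOver φ φ' := by
  rw [CoveringClass.mk_eq_mk_iff]
  constructor
  · rintro ⟨h, hh⟩
    obtain ⟨ψ, hψ⟩ := hφ'.isCombCovering.exists_simplicialMap_of_realization h.continuous hh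
    obtain ⟨ψ', hψ'⟩ := hφ.isCombCovering.exists_simplicialMap_of_realization h.symm.continuous
      fun y => by rw [← hh, h.apply_symm_apply]
    refine ⟨ψ, ψ', fun w => ?_, fun w => ?_, fun w => ?_⟩ <;> apply vertexPoint_injective
    · rw [← hψ', ← hψ, h.symm_apply_apply]
    · rw [← hψ, ← hψ', h.apply_symm_apply]
    · rw [← φ'.realization_vertexPoint, ← hψ, hh, φ.realization_vertexPoint]
  · rintro ⟨ψ, ψ', hl, hr, hψ⟩
    exact ⟨⟨⟨ψ.realization, ψ'.realization, SimplicialMap.realization_leftInverse hl,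
      SimplicialMap.realization_leftInverse hr⟩, ψ.continuous_realization,
      ψ'.continuous_realization⟩, SimplicialMap.realization_realization hψ⟩

/-! ### Coverings of a realization are simplicial -/

section VertexLift

variable {V X E : Type*}

/-- The points of `E` over the image of `ι : V → X` under `q : E → X`. With `ι` the inclusion of
the vertices of a complex `K` into `|K|` or into its face poset, these are the vertices of the
complex that a covering `q` comes from. -/
def VertexLift (ι : V → X) (q : E → X) := {e : E // q e ∈ range ι}

variable {ι : V → X} {q : E → X}

/-- The element of `V` below a point of `VertexLift ι q`. -/
noncomputable def VertexLift.label (w : VertexLift ι q) : V := w.2.choose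

theorem VertexLift.apply_label (w : VertexLift ι q) : ι w.label = q w.1 := w.2.choose_spec

theorem VertexLift.label_eq (hι : Injective ι) {w : VertexLift ι q} {v : V} (h : q w.1 = ι v) :
    w.label = v :=
  hι (w.apply_label.trans h)

end VertexLift

section SimplexLift

variable {V E S T : Type*} [TopologicalSpace E] {K : AbstractSimplicialComplex V}
  {q : E → Realization K} [Fintype S] [Fintype T] [DecidableEq S] [DecidableEq T]

open VertexLift

/-- `F` is a lift along `q` of the simplex of `K` with the vertices `(c i).label`, and its own
vertices are the `c i`. -/
structure IsSimplexLift (c : T → VertexLift (vertexPoint K) q) (F : stdSimplex ℝ T → E) :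
    Prop where
  continuous : Continuous F
  inFace : InFace K (range (label ∘ c))
  proj : ∀ a, q (F a) = affineSimplex (label ∘ c) inFace a
  vertex : ∀ i, F (stdSimplex.vertex i) = (c i).1

variable {c c' : T → VertexLift (vertexPoint K) q} {F F' : stdSimplex ℝ T → E}

theorem IsSimplexLift.comp_map (h : IsSimplexLift c F) (g : S → T) :
    IsSimplexLift (c ∘ g) (F ∘ stdSimplex.map g) where
  continuous := h.continuous.comp (stdSimplex.continuous_map g)
  inFace := h.inFace.mono (range_comp_subset_range g (label ∘ c))
  proj a := by
    rw [comp_apply, h.proj, affineSimplex_map]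
    rfl
  vertex i := by rw [comp_apply, stdSimplex.map_vertex, h.vertex, comp_apply]

theorem IsSimplexLift.eq_of_apply_eq (h : IsSimplexLift c F) (h' : IsSimplexLift c' F')
    (hq : IsCovering q) (hlabel : label ∘ c = label ∘ c') {a : stdSimplex ℝ T} (ha : F a = F' a) :
    c = c' ∧ F = F' := by
  have hFF' : F = F' := hq.eq_of_lifts h.continuous h'.continuous
    (fun b => by simp only [h.proj, h'.proj, hlabel]) ha
  exact ⟨funext fun i => Subtype.ext (by rw [← h.vertex, ← h'.vertex, hFF']), hFF'⟩

theorem IsCovering.exists_isSimplexLift [Nonempty T] (hq : IsCovering q) {f : T → V}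
    (hf : InFace K (range f)) {a : stdSimplex ℝ T} {e : E} (he : q e = affineSimplex f hf a) :
    ∃ c F, IsSimplexLift (q := q) c F ∧ label ∘ c = f ∧ F a = e := by
  obtain ⟨F, hF, hFf, hFa⟩ := hq.exists_lift (continuous_affineSimplex f hf) he
  have proj_vertex (i : T) : q (F (stdSimplex.vertex i)) = vertexPoint K (f i) := by
    rw [hFf, affineSimplex_vertex]
  let c (i : T) : VertexLift (vertexPoint K) q :=
    ⟨F (stdSimplex.vertex i), f i, (proj_vertex i).symm⟩
  have hc : label ∘ c = f := funext fun i => label_eq vertexPoint_injective (proj_vertex i)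
  exact ⟨c, F, ⟨hF, by rwa [hc], fun b => by simp only [hFf, hc], fun _ => rfl⟩, hc, hFa⟩

open Classical in
/-- The complex that the covering `q` of `|K|` comes from: its simplices are the lifts of the
simplices of `K`, given by their vertices. -/
def liftComplex (hq : IsCovering q) :
    AbstractSimplicialComplex (VertexLift (vertexPoint K) q) where
  faces := {t | t.Nonempty ∧ ∃ F, IsSimplexLift (Subtype.val : t → _) F}
  isRelLowerSet_faces := fun _ ⟨ht, _, hF⟩ =>
    ⟨ht, fun _ hts hs => ⟨hs, _, hF.comp_map (inclusion hts)⟩⟩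
  singleton_mem w := by
    let i : ({w} : Finset (VertexLift (vertexPoint K) q)) := ⟨w, Finset.mem_singleton_self w⟩
    have : Nonempty ({w} : Finset (VertexLift (vertexPoint K) q)) := ⟨i⟩
    obtain ⟨c, F, hF, -, hFw⟩ := hq.exists_isSimplexLift (a := stdSimplex.vertex i) (e := w.1)
      (f := fun _ : ({w} : Finset (VertexLift (vertexPoint K) q)) => w.label)
      ((inFace_singleton w.label).mono (range_subset_iff.2 fun _ => rfl))
      (by rw [affineSimplex_vertex, w.apply_label])
    have hc : c = Subtype.val := funext fun j => by
      rw [Subsingleton.elim j i]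
      exact Subtype.ext ((hF.vertex i).symm.trans hFw)
    exact ⟨Finset.singleton_nonempty w, F, hc ▸ hF⟩

variable {hq : IsCovering q}

theorem exists_isSimplexLift_of_inFace (h : InFace (liftComplex hq) (range c)) :
    ∃ F, IsSimplexLift c F := by
  classical
  obtain ⟨s, ⟨-, F, hF⟩, hcs⟩ := h
  exact ⟨_, hF.comp_map fun i => ⟨c i, hcs (mem_range_self i)⟩⟩

theorem IsSimplexLift.exists_mem_liftComplex [Nonempty T] (h : IsSimplexLift c F)
    (hq : IsCovering q) : ∃ t ∈ liftComplex hq, (t : Set _) = range c := by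
  classical
  obtain ⟨t, ht⟩ := (finite_range c).exists_finset_coe
  choose g hg using fun w : t => ht.subset w.2
  have hF := h.comp_map g
  rw [(funext hg : c ∘ g = Subtype.val)] at hF
  exact ⟨t, ⟨Finset.coe_nonempty.1 (ht ▸ range_nonempty c), _, hF⟩, ht⟩

theorem IsSimplexLift.inFace_range [Nonempty T] (h : IsSimplexLift c F) (hq : IsCovering q) :
    InFace (liftComplex hq) (range c) :=
  let ⟨t, ht, htc⟩ := h.exists_mem_liftComplex hq
  ⟨t, ht, htc.ge⟩

/-- The simplicial map from the complex of lifts to `K`. -/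
noncomputable def liftComplexMap (hq : IsCovering q) : SimplicialMap (liftComplex hq) K :=
  .ofInFace label fun t ht => by
    classical
    obtain ⟨-, _, hF⟩ := ht
    simpa [range_comp] using hF.inFace

theorem isCombCovering_liftComplexMap : IsCombCovering (liftComplexMap hq) where
  surjective v := by
    obtain ⟨e, he⟩ := hq.2 (vertexPoint K v)
    exact ⟨⟨e, v, he.symm⟩, label_eq vertexPoint_injective he⟩
  eq_of_inFace {w x y} hx hy hxy := by
    rw [← Matrix.range_cons_cons_empty _ _ ![]] at hx hy
    obtain ⟨F, hF⟩ := exists_isSimplexLift_of_inFace hx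
    obtain ⟨F', hF'⟩ := exists_isSimplexLift_of_inFace hy
    have hlabel : label ∘ ![w, x] = label ∘ ![w, y] := by
      ext i; fin_cases i
      exacts [rfl, hxy]
    exact congrFun (hF.eq_of_apply_eq hF' hq hlabel (a := stdSimplex.vertex 0)
      (by rw [hF.vertex, hF'.vertex]; rfl)).1 1
  exists_lift w s hs hw := by
    classical
    let i : s := ⟨_, hw⟩
    have : Nonempty s := ⟨i⟩
    obtain ⟨c, F, hF, hc, hFw⟩ := hq.exists_isSimplexLift (inFace_range_val hs)
      (a := stdSimplex.vertex i) (e := w.1)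
      (by rw [affineSimplex_vertex]; exact w.apply_label.symm)
    obtain ⟨t, ht, htc⟩ := hF.exists_mem_liftComplex hq
    refine ⟨t, ht, ?_, ?_⟩
    · rw [← Finset.mem_coe, htc]
      exact ⟨i, Subtype.ext ((hF.vertex i).symm.trans hFw)⟩
    · rw [htc, ← range_comp]
      exact (congrArg range hc).trans Subtype.range_coe

open Classical in
/-- The map from `|liftComplex hq|` to `E` given on each simplex by the lift it stands for. -/
noncomputable def liftComplexEval (hq : IsCovering q) (y : Realization (liftComplex hq)) : E :=
  y.support_mem.2.choose (y.exists_affineSimplex_val_eq y.support_mem Subset.rfl).choose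

theorem IsSimplexLift.liftComplexEval_affineSimplex (h : IsSimplexLift c F) (hinj : Injective c)
    (hc : InFace (liftComplex hq) (range c)) (a : stdSimplex ℝ T) :
    liftComplexEval hq (affineSimplex c hc a) = F a := by
  classical
  set y := affineSimplex c hc a with hy
  have hF := y.support_mem.2.choose_spec
  have hb := (y.exists_affineSimplex_val_eq y.support_mem Subset.rfl).choose_spec
  set b := (y.exists_affineSimplex_val_eq y.support_mem Subset.rfl).choose
  have support_subset : (y.coord.support : Set _) ⊆ range c := by
    rw [hy, support_affineSimplex]
    exact image_subset_range _ _
  choose g hg using fun w : y.coord.support => support_subset w.2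
  have hcg : c ∘ g = Subtype.val := funext hg
  have hFg := h.comp_map g
  obtain ⟨w, hw⟩ := nonempty_of_mem y.support_mem
  have eq_comp : y.support_mem.2.choose = F ∘ stdSimplex.map g :=
    (hF.eq_of_apply_eq hFg hq (by rw [hcg]) (a := stdSimplex.vertex ⟨w, hw⟩)
      (by rw [hF.vertex, hFg.vertex, hcg])).2
  have hab : a = stdSimplex.map g b := by
    refine affineSimplex_injective hc hinj ?_
    rw [affineSimplex_map, ← hy]
    exact hb.symm.trans (by simp only [hcg])
  rw [liftComplexEval, eq_comp, hab]
  rfl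

theorem apply_liftComplexEval (y : Realization (liftComplex hq)) :
    q (liftComplexEval hq y) = (liftComplexMap hq).realization y := by
  classical
  obtain ⟨a, ha⟩ := y.exists_affineSimplex_val_eq y.support_mem Subset.rfl
  obtain ⟨F, hF⟩ := exists_isSimplexLift_of_inFace (inFace_range_val y.support_mem)
  rw [← ha, hF.liftComplexEval_affineSimplex Subtype.val_injective, hF.proj,
    SimplicialMap.realization_affineSimplex]
  rfl

theorem continuous_liftComplexEval : Continuous (liftComplexEval hq) := by
  classical
  refine Realization.continuous_iff.2 fun s hs => ?_
  obtain ⟨F, hF⟩ := exists_isSimplexLift_of_inFace (inFace_range_val hs)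
  simpa only [hF.liftComplexEval_affineSimplex Subtype.val_injective] using hF.continuous

theorem liftComplexEval_injective : Injective (liftComplexEval hq) := by
  classical
  intro y y' hyy'
  have hφ := isCombCovering_liftComplexMap (hq := hq)
  obtain ⟨x, hy, hy'⟩ : ∃ x, (liftComplexMap hq).realization y = x ∧
      (liftComplexMap hq).realization y' = x :=
    ⟨q (liftComplexEval hq y'), (apply_liftComplexEval y).symm.trans (congrArg q hyy'),
      (apply_liftComplexEval y').symm⟩
  obtain ⟨a, ha⟩ := x.exists_affineSimplex_val_eq x.support_mem Subset.rfl
  obtain ⟨c, hcL, hc, rfl⟩ := hφ.exists_eq_affineSimplex x.support_mem (hy.trans ha.symm)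
  obtain ⟨c', hcL', hc', rfl⟩ := hφ.exists_eq_affineSimplex x.support_mem (hy'.trans ha.symm)
  obtain ⟨F, hF⟩ := exists_isSimplexLift_of_inFace hcL
  obtain ⟨F', hF'⟩ := exists_isSimplexLift_of_inFace hcL'
  rw [hF.liftComplexEval_affineSimplex (.of_comp (hc ▸ Subtype.val_injective)),
    hF'.liftComplexEval_affineSimplex (.of_comp (hc' ▸ Subtype.val_injective))] at hyy'
  obtain ⟨rfl, -⟩ := hF.eq_of_apply_eq hF' hq (hc.trans hc'.symm) hyy'
  rfl

theorem liftComplexEval_surjective : Surjective (liftComplexEval hq) := by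
  classical
  intro e
  obtain ⟨v, hv⟩ := (q e).exists_mem_openStar
  have : Nonempty (q e).coord.support := ⟨v, hv⟩
  obtain ⟨a, ha⟩ := (q e).exists_affineSimplex_val_eq (q e).support_mem Subset.rfl
  obtain ⟨c, F, hF, hc, hFa⟩ := hq.exists_isSimplexLift _ ha.symm
  refine ⟨affineSimplex c (hF.inFace_range hq) a, ?_⟩
  rw [hF.liftComplexEval_affineSimplex (.of_comp (hc ▸ Subtype.val_injective)), hFa]

theorem isLocalHomeomorph_liftComplexEval : IsLocalHomeomorph (liftComplexEval hq) := by
  refine .of_comp (g := q) ?_ hq.1.isLocalHomeomorph continuous_liftComplexEval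
  rw [(funext apply_liftComplexEval : q ∘ liftComplexEval hq = (liftComplexMap hq).realization)]
  exact isCombCovering_liftComplexMap.isCovering.1.isLocalHomeomorph

end SimplexLift

theorem exists_mk_realization_eq {V : Type u} {K : AbstractSimplicialComplex V}
    (c : CoveringClass.{u, v} (Realization K)) :
    ∃ (W : Type v) (L : AbstractSimplicialComplex W) (φ : SimplicialMap L K)
      (hφ : IsCovering φ.realization), CoveringClass.mk φ.realization hφ = c := by
  obtain ⟨E, _, q, hq, rfl⟩ := c.exists_mk_eq
  refine ⟨_, _, liftComplexMap hq, isCombCovering_liftComplexMap.isCovering,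
    (CoveringClass.mk_eq_mk_iff _ hq).2 ⟨isLocalHomeomorph_liftComplexEval.toHomeomorphOfBijective
      ⟨liftComplexEval_injective, liftComplexEval_surjective⟩, apply_liftComplexEval⟩⟩

/-! ### Order complexes -/

section OrderComplex

variable {E E' B W : Type*} [TopologicalSpace E] [TopologicalSpace E'] [TopologicalSpace B]
  {p : C(E, B)} {p' : C(E', B)}

theorem inFace_orderComplex_of_isChain {A : Set B} (hA : A.Finite) (hne : A.Nonempty)
    (hc : IsChain (· ⤳ ·) A) : InFace (orderComplex B) A :=
  ⟨hA.toFinset, ⟨hA.toFinset_nonempty.2 hne, by rwa [hA.coe_toFinset]⟩, hA.coe_toFinset.ge⟩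

theorem inFace_orderComplex_pair {x y : B} : InFace (orderComplex B) {x, y} ↔ x ⤳ y ∨ y ⤳ x := by
  constructor
  · rintro ⟨s, hs, hxy⟩
    have : Std.Refl (fun x y : B => x ⤳ y) := ⟨specializes_refl⟩
    exact hs.2.total (hxy (mem_insert _ _)) (hxy (mem_insert_of_mem _ rfl))
  · rintro (h | h)
    · exact inFace_orderComplex_of_isChain (toFinite _) (insert_nonempty _ _) (.pair h)
    · rw [pair_comm]
      exact inFace_orderComplex_of_isChain (toFinite _) (insert_nonempty _ _) (.pair h)

theorem IsCovering.specializes_of_comparable [AlexandrovDiscrete B] (hp : IsCovering p)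
    {w x y : E} (hx : InFace (orderComplex E) {w, x}) (hy : InFace (orderComplex E) {w, y})
    (hxy : p x ⤳ p y) : x ⤳ y := by
  rw [inFace_orderComplex_pair] at hx hy
  obtain ⟨x', hx'y, hx'⟩ := hp.exists_lift_below hxy
  obtain ⟨y', hxy', hy'⟩ := hp.exists_lift_above hxy
  rcases hx with hwx | hxw <;> rcases hy with hwy | hyw
  · rwa [hp.eq_of_above hwy (hwx.trans hxy') hy'.symm]
  · rwa [← hp.eq_of_specializes (hx'y.trans (hyw.trans hwx)) hx']
  · exact hxw.trans hwy
  · rwa [hp.eq_of_below hxw (hx'y.trans hyw) hx'.symm]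

theorem IsCovering.exists_comparable_lift [AlexandrovDiscrete B] (hp : IsCovering p) {w : E}
    {b : B} (h : InFace (orderComplex B) {p w, b}) :
    ∃ x, InFace (orderComplex E) {w, x} ∧ p x = b := by
  simp only [inFace_orderComplex_pair] at h ⊢
  rcases h with h | h
  · exact (hp.exists_lift_above h).imp fun _ => .imp_left .inl
  · exact (hp.exists_lift_below h).imp fun _ => .imp_left .inr

theorem IsCovering.specializes_iff [AlexandrovDiscrete B] (hp : IsCovering p) {x y : E} :
    x ⤳ y ↔ InFace (orderComplex E) {x, y} ∧ p x ⤳ p y := by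
  refine ⟨fun h => ⟨inFace_orderComplex_pair.2 (.inl h), h.map p.continuous⟩, fun h => ?_⟩
  exact hp.specializes_of_comparable (inFace_orderComplex_pair.2 (.inl specializes_rfl)) h.1 h.2

theorem IsCovering.isCombCovering_orderComplexMap [AlexandrovDiscrete B] (hp : IsCovering p) :
    IsCombCovering (orderComplexMap p) := by
  have eq_of_comparable {w x y : E} (hx : InFace (orderComplex E) {w, x})
      (hy : InFace (orderComplex E) {w, y}) (hxy : p x = p y) : x = y :=
    hp.eq_of_specializes (hp.specializes_of_comparable hx hy (specializes_of_eq hxy)) hxy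
  refine ⟨hp.2, eq_of_comparable, fun w s hs hw => ?_⟩
  choose g hgw hg using fun b : s => hp.exists_comparable_lift (inFace_pair hs hw b.2)
  obtain ⟨t, ht⟩ := (finite_range g).exists_finset_coe
  have hwg : w ∈ range g :=
    ⟨⟨_, hw⟩, eq_of_comparable (hgw _) (inFace_orderComplex_pair.2 (.inl specializes_rfl)) (hg _)⟩
  refine ⟨t, ⟨⟨w, ht.superset hwg⟩, ?_⟩, ht.superset hwg, ?_⟩
  · rw [ht]
    rintro _ ⟨b, rfl⟩ _ ⟨b', rfl⟩ hne
    have hbb' : (b : B) ≠ b' := fun h => hne (congrArg g (Subtype.ext h))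
    refine (hs.2 b.2 b'.2 hbb').imp (fun h => ?_) (fun h => ?_) <;>
      refine hp.specializes_of_comparable (hgw _) (hgw _) ?_ <;> rwa [hg, hg]
  · rw [ht, ← range_comp]
    exact (congrArg range (funext hg)).trans Subtype.range_coe

theorem IsCovering.specializes_map [AlexandrovDiscrete B] (hp : IsCovering p)
    (hp' : IsCovering p') {ψ : SimplicialMap (orderComplex E) (orderComplex E')}
    (hψ : ∀ e, p' (ψ.toFun e) = p e) {x y : E} (h : x ⤳ y) : ψ.toFun x ⤳ ψ.toFun y := by
  rw [hp.specializes_iff] at h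
  rw [hp'.specializes_iff, hψ, hψ, ← image_pair]
  exact ⟨ψ.inFace_image h.1, h.2⟩

theorem isoOver_orderComplexMap_iff [AlexandrovDiscrete B] (hp : IsCovering p)
    (hp' : IsCovering p') :
    IsoOver (orderComplexMap p) (orderComplexMap p') ↔ ∃ h : E ≃ₜ E', ∀ e, p' (h e) = p e := by
  constructor
  · rintro ⟨ψ, ψ', hl, hr, hψ⟩
    have := hp.alexandrovDiscrete
    have := hp'.alexandrovDiscrete
    have hψ' (e : E') : p (ψ'.toFun e) = p' e :=
      (hψ _).symm.trans (congrArg p' (hr e))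
    exact ⟨⟨⟨ψ.toFun, ψ'.toFun, hl, hr⟩,
      continuous_of_specializes fun _ _ => hp.specializes_map hp' hψ,
      continuous_of_specializes fun _ _ => hp'.specializes_map hp hψ'⟩, hψ⟩
  · rintro ⟨h, hh⟩
    exact ⟨orderComplexMap (h : C(E, E')), orderComplexMap (h.symm : C(E', E)),
      h.symm_apply_apply, h.apply_symm_apply, hh⟩

variable {L : AbstractSimplicialComplex W} {φ : SimplicialMap L (orderComplex B)}

theorem IsCombCovering.trans_of_orderComplex (hφ : IsCombCovering φ) {x y z : W}
    (hxy : InFace L {x, y}) (hyz : InFace L {y, z}) (hφxy : φ.toFun x ⤳ φ.toFun y)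
    (hφyz : φ.toFun y ⤳ φ.toFun z) : InFace L {x, z} := by
  have chain : IsChain (· ⤳ ·) {φ.toFun y, φ.toFun x, φ.toFun z} := by
    refine IsChain.insert (.pair (hφxy.trans hφyz)) ?_
    rintro _ (rfl | rfl) _
    exacts [.inr hφxy, .inl hφyz]
  obtain ⟨s, hs, hsub⟩ := inFace_orderComplex_of_isChain (toFinite _) (insert_nonempty _ _) chain
  simp only [insert_subset_iff, singleton_subset_iff] at hsub
  obtain ⟨t, ht, hyt, hts⟩ := hφ.exists_lift y s hs hsub.1
  have mem_of_edge {w : W} (hw : InFace L {y, w}) (hws : φ.toFun w ∈ s) : w ∈ t :=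
    hφ.mem_of_inFace (inFace_coe ht) hyt hw (hts.superset hws)
  exact inFace_pair ht (mem_of_edge (pair_comm x y ▸ hxy) hsub.2.1) (mem_of_edge hyz hsub.2.2)

theorem IsCombCovering.isCovering_of_specializes_iff [AlexandrovDiscrete B] [TopologicalSpace W]
    [AlexandrovDiscrete W] (hφ : IsCombCovering φ)
    (h : ∀ x y : W, x ⤳ y ↔ InFace L {x, y} ∧ φ.toFun x ⤳ φ.toFun y) : IsCovering φ.toFun := by
  have h_below (e x : W) : x ⤳ e ↔ InFace L {e, x} ∧ φ.toFun x ⤳ φ.toFun e := by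
    rw [h, pair_comm]
  refine isCovering_of_lifts (fun x y hxy => ((h x y).1 hxy).2) hφ.surjective ?_ ?_ ?_ ?_
  · intro e b hb
    obtain ⟨x, hx, rfl⟩ := hφ.exists_edge_lift (inFace_orderComplex_pair.2 (.inr hb))
    exact ⟨x, (h_below e x).2 ⟨hx, hb⟩, rfl⟩
  · exact fun e x y hx hy => hφ.eq_of_inFace ((h_below e x).1 hx).1 ((h_below e y).1 hy).1
  · intro e b hb
    obtain ⟨x, hx, rfl⟩ := hφ.exists_edge_lift (inFace_orderComplex_pair.2 (.inl hb))
    exact ⟨x, (h e x).2 ⟨hx, hb⟩, rfl⟩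
  · exact fun e x y hx hy => hφ.eq_of_inFace ((h e x).1 hx).1 ((h e y).1 hy).1

/-- The total space is the set of vertices of `L`, topologized so that `x ⤳ y` iff `x` and `y`
span a simplex of `L` and `φ x ⤳ φ y`. -/
theorem IsCombCovering.exists_orderComplexMap_isoOver [AlexandrovDiscrete B]
    (hφ : IsCombCovering φ) :
    ∃ (_ : TopologicalSpace W) (p : C(W, B)), IsCovering p ∧ IsoOver (orderComplexMap p) φ := by
  obtain ⟨_, _, h⟩ := exists_alexandrovDiscrete_specializes_iff
    (r := fun x y => InFace L {x, y} ∧ φ.toFun x ⤳ φ.toFun y)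
    (fun x => ⟨by simpa using inFace_singleton x, specializes_rfl⟩)
    fun x y z hxy hyz =>
      ⟨hφ.trans_of_orderComplex hxy.1 hyz.1 hxy.2 hyz.2, hxy.2.trans hyz.2⟩
  have hp := hφ.isCovering_of_specializes_iff h
  have inFace_iff (w x : W) : InFace (orderComplex W) {w, x} ↔ InFace L {w, x} := by
    rw [inFace_orderComplex_pair, h, h, pair_comm x w, ← and_or_left, and_iff_left_of_imp]
    intro hwx
    rw [← inFace_orderComplex_pair, ← image_pair]
    exact φ.inFace_image hwx
  exact ⟨_, ⟨φ.toFun, hp.continuous⟩, hp, isoOver_of_edges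
    (IsCovering.isCombCovering_orderComplexMap (p := ⟨φ.toFun, hp.continuous⟩) hp) hφ
    (.refl W) (fun _ => rfl) inFace_iff⟩

end OrderComplex

/-! ### Face posets -/

section FacePosetMap

variable {V W W' : Type*} {K : AbstractSimplicialComplex V} {L : AbstractSimplicialComplex W}
  {L' : AbstractSimplicialComplex W'} {φ : SimplicialMap L K} {φ' : SimplicialMap L' K}

instance : Topology.IsLowerSet (FacePoset K) := ⟨rfl⟩

namespace FacePoset

theorem ext_coe {σ τ : FacePoset K} (h : (σ.simplex : Set V) = τ.simplex) : σ = τ :=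
  FacePoset.ext (Finset.coe_injective h)

theorem specializes_iff {σ τ : FacePoset K} :
    σ ⤳ τ ↔ (σ.simplex : Set V) ⊆ τ.simplex :=
  Topology.IsLowerSet.specializes_iff_le

instance : T0Space (FacePoset K) := ⟨fun _ _ h =>
  ext_coe ((specializes_iff.1 h.specializes).antisymm (specializes_iff.1 h.specializes'))⟩

/-- The vertex `v` as an element of the face poset. -/
def vertex (K : AbstractSimplicialComplex V) (v : V) : FacePoset K := ⟨{v}, K.singleton_mem v⟩

theorem vertex_injective : Injective (vertex K) := fun _ _ h =>
  Finset.singleton_injective (congrArg simplex h)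

theorem vertex_specializes {v : V} {σ : FacePoset K} : vertex K v ⤳ σ ↔ v ∈ σ.simplex := by
  simp [specializes_iff, vertex]

end FacePoset

theorem SimplicialMap.coe_facePoset_simplex (φ : SimplicialMap L K) (σ : FacePoset L) :
    ((φ.facePoset σ).simplex : Set V) = φ.toFun '' σ.simplex := by
  classical
  exact Finset.coe_image

theorem SimplicialMap.facePoset_specializes (φ : SimplicialMap L K) {σ τ : FacePoset L}
    (h : σ ⤳ τ) : φ.facePoset σ ⤳ φ.facePoset τ := by
  simp only [FacePoset.specializes_iff, coe_facePoset_simplex] at h ⊢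
  exact image_mono h

theorem SimplicialMap.facePoset_vertex (φ : SimplicialMap L K) (w : W) :
    φ.facePoset (FacePoset.vertex L w) = FacePoset.vertex K (φ.toFun w) :=
  FacePoset.ext_coe (by simp [coe_facePoset_simplex, FacePoset.vertex])

theorem SimplicialMap.facePoset_leftInverse {ψ : SimplicialMap L L'} {ψ' : SimplicialMap L' L}
    (h : LeftInverse ψ'.toFun ψ.toFun) : LeftInverse ψ'.facePoset ψ.facePoset := fun σ =>
  FacePoset.ext_coe (by rw [coe_facePoset_simplex, coe_facePoset_simplex, h.image_image])

theorem SimplicialMap.facePoset_facePoset {ψ : SimplicialMap L L'}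
    (h : ∀ w, φ'.toFun (ψ.toFun w) = φ.toFun w) (σ : FacePoset L) :
    φ'.facePoset (ψ.facePoset σ) = φ.facePoset σ :=
  FacePoset.ext_coe (by simp only [coe_facePoset_simplex, image_image, h])

theorem SimplicialMap.exists_facePoset_below (φ : SimplicialMap L K) {σ : FacePoset L}
    {τ : FacePoset K} (hτ : τ ⤳ φ.facePoset σ) :
    ∃ σ' : FacePoset L, σ' ⤳ σ ∧ φ.facePoset σ' = τ := by
  classical
  rw [FacePoset.specializes_iff, φ.coe_facePoset_simplex] at hτ
  obtain ⟨t, hts, ht⟩ := Finset.subset_set_image_iff.1 hτ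
  have ht_nonempty : t.Nonempty := Finset.image_nonempty.1 (ht ▸ nonempty_of_mem τ.mem)
  refine ⟨⟨t, ((inFace_coe σ.mem).mono hts).mem ht_nonempty⟩,
    FacePoset.specializes_iff.2 hts, FacePoset.ext_coe ?_⟩
  rw [φ.coe_facePoset_simplex, ← ht, Finset.coe_image]

namespace IsCombCovering

theorem exists_facePoset_above (hφ : IsCombCovering φ) {σ : FacePoset L} {τ : FacePoset K}
    (hτ : φ.facePoset σ ⤳ τ) : ∃ σ', σ ⤳ σ' ∧ φ.facePoset σ' = τ := by
  rw [FacePoset.specializes_iff, φ.coe_facePoset_simplex, image_subset_iff] at hτ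
  obtain ⟨w, hw⟩ := nonempty_of_mem σ.mem
  obtain ⟨t, ht, hwt, hts⟩ := hφ.exists_lift w τ.simplex τ.mem (hτ hw)
  refine ⟨⟨t, ht⟩, FacePoset.specializes_iff.2 fun x hx => ?_,
    FacePoset.ext_coe ((φ.coe_facePoset_simplex _).trans hts)⟩
  exact hφ.mem_of_inFace (inFace_coe ht) hwt (inFace_pair σ.mem hw hx) (hts.superset (hτ hx))

theorem specializes_of_facePoset (hφ : IsCombCovering φ) {ρ σ τ : FacePoset L} (hσ : ρ ⤳ σ)
    (hτ : ρ ⤳ τ) (hστ : φ.facePoset σ ⤳ φ.facePoset τ) : σ ⤳ τ := by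
  simp only [FacePoset.specializes_iff, φ.coe_facePoset_simplex] at *
  obtain ⟨w, hw⟩ := nonempty_of_mem ρ.mem
  exact fun x hx => hφ.mem_of_inFace (inFace_coe τ.mem) (hτ hw) (inFace_pair σ.mem (hσ hw) hx)
    (hστ (mem_image_of_mem _ hx))

theorem isCovering_facePoset (hφ : IsCombCovering φ) : IsCovering φ.facePoset := by
  refine isCovering_of_lifts (fun _ _ => φ.facePoset_specializes) (fun τ => ?_)
    (fun _ _ => φ.exists_facePoset_below) (fun ρ σ τ hσ hτ hστ => ?_)
    (fun _ _ => hφ.exists_facePoset_above) (fun ρ σ τ hσ hτ hστ => ?_)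
  · obtain ⟨v, hv⟩ := nonempty_of_mem τ.mem
    obtain ⟨w, rfl⟩ := hφ.surjective v
    obtain ⟨t, ht, -, hts⟩ := hφ.exists_lift w _ τ.mem hv
    exact ⟨⟨t, ht⟩, FacePoset.ext_coe ((φ.coe_facePoset_simplex _).trans hts)⟩
  · have himage := congrArg (fun σ => (σ.simplex : Set V)) hστ
    simp only [φ.coe_facePoset_simplex] at himage
    exact FacePoset.ext_coe (((hφ.injOn (inFace_coe ρ.mem)).image_eq_image_iff
      (FacePoset.specializes_iff.1 hσ) (FacePoset.specializes_iff.1 hτ)).1 himage)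
  · exact ((hφ.specializes_of_facePoset hσ hτ (specializes_of_eq hστ)).antisymm
      (hφ.specializes_of_facePoset hτ hσ (specializes_of_eq hστ.symm))).eq

theorem exists_eq_vertex (hφ : IsCombCovering φ) {σ : FacePoset L} {v : V}
    (hσ : φ.facePoset σ = FacePoset.vertex K v) :
    ∃ w, σ = FacePoset.vertex L w := by
  have label_eq {x : W} (hx : x ∈ σ.simplex) : φ.toFun x = v := by
    have := mem_image_of_mem φ.toFun (Finset.mem_coe.2 hx)
    rw [← φ.coe_facePoset_simplex, hσ] at this
    exact Finset.mem_singleton.1 this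
  obtain ⟨w, hw⟩ := nonempty_of_mem σ.mem
  refine ⟨w, FacePoset.ext (Finset.eq_singleton_iff_unique_mem.2 ⟨hw, fun x hx => ?_⟩)⟩
  exact hφ.injOn (inFace_coe σ.mem) hx hw ((label_eq hx).trans (label_eq hw).symm)

theorem exists_simplicialMap_of_facePoset (hφ' : IsCombCovering φ')
    {k : FacePoset L → FacePoset L'} (hk : Continuous k)
    (hkφ : ∀ σ, φ'.facePoset (k σ) = φ.facePoset σ) :
    ∃ ψ : SimplicialMap L L', ∀ w, k (FacePoset.vertex L w) = FacePoset.vertex L' (ψ.toFun w) := by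
  choose g hg using fun w => hφ'.exists_eq_vertex ((hkφ _).trans (φ.facePoset_vertex w))
  refine ⟨.ofInFace g fun t ht => (inFace_coe (k ⟨t, ht⟩).mem).mono ?_, hg⟩
  rintro _ ⟨w, hw, rfl⟩
  have : FacePoset.vertex L w ⤳ ⟨t, ht⟩ := FacePoset.vertex_specializes.2 hw
  exact FacePoset.vertex_specializes.1 (hg w ▸ this.map hk)

end IsCombCovering

end FacePosetMap

theorem mk_facePoset_eq_iff {V : Type u} {W W' : Type v} {K : AbstractSimplicialComplex V}
    {L : AbstractSimplicialComplex W} {L' : AbstractSimplicialComplex W'} {φ : SimplicialMap L K}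
    {φ' : SimplicialMap L' K} (hφ : IsCombCovering φ) (hφ' : IsCombCovering φ') :
    CoveringClass.mk φ.facePoset hφ.isCovering_facePoset =
      CoveringClass.mk φ'.facePoset hφ'.isCovering_facePoset ↔ IsoOver φ φ' := by
  rw [CoveringClass.mk_eq_mk_iff]
  constructor
  · rintro ⟨h, hh⟩
    obtain ⟨ψ, hψ⟩ := hφ'.exists_simplicialMap_of_facePoset h.continuous hh
    obtain ⟨ψ', hψ'⟩ := hφ.exists_simplicialMap_of_facePoset h.symm.continuous
      fun y => by rw [← hh, h.apply_symm_apply]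
    refine ⟨ψ, ψ', fun w => ?_, fun w => ?_, fun w => ?_⟩ <;> apply FacePoset.vertex_injective
    · rw [← hψ', ← hψ, h.symm_apply_apply]
    · rw [← hψ, ← hψ', h.apply_symm_apply]
    · rw [← φ'.facePoset_vertex, ← hψ, hh, φ.facePoset_vertex]
  · rintro ⟨ψ, ψ', hl, hr, hψ⟩
    exact ⟨⟨⟨ψ.facePoset, ψ'.facePoset, SimplicialMap.facePoset_leftInverse hl,
      SimplicialMap.facePoset_leftInverse hr⟩,
      continuous_of_specializes fun _ _ => ψ.facePoset_specializes,
      continuous_of_specializes fun _ _ => ψ'.facePoset_specializes⟩,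
      SimplicialMap.facePoset_facePoset hψ⟩

/-! ### Coverings of a face poset are simplicial -/

section VertexSet

variable {V E : Type*} [TopologicalSpace E] {K : AbstractSimplicialComplex V}
  {q : E → FacePoset K}

open VertexLift

/-- The vertices below a point `e` of a covering `q` of the face poset of `K`. -/
def vertexSet (q : E → FacePoset K) (e : E) : Set (VertexLift (FacePoset.vertex K) q) :=
  {w | w.1 ⤳ e}

theorem IsCovering.label_injOn_vertexSet (hq : IsCovering q) (e : E) :
    (vertexSet q e).InjOn label := fun w hw w' hw' h =>
  Subtype.ext (hq.eq_of_below hw hw' (by rw [← w.apply_label, h, w'.apply_label]))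

theorem IsCovering.image_label_vertexSet (hq : IsCovering q) (e : E) :
    label '' vertexSet q e = (q e).simplex := by
  ext v
  rw [Finset.mem_coe, ← FacePoset.vertex_specializes]
  constructor
  · rintro ⟨w, hw, rfl⟩
    rw [w.apply_label]
    exact hw.map hq.continuous
  · intro hv
    obtain ⟨e', he', hv'⟩ := hq.exists_lift_below hv
    exact ⟨⟨e', v, hv'.symm⟩, he', label_eq FacePoset.vertex_injective hv'⟩

theorem IsCovering.finite_vertexSet (hq : IsCovering q) (e : E) : (vertexSet q e).Finite :=
  .of_finite_image (by rw [hq.image_label_vertexSet]; exact Finset.finite_toSet _)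
    (hq.label_injOn_vertexSet e)

theorem IsCovering.vertexSet_nonempty (hq : IsCovering q) (e : E) : (vertexSet q e).Nonempty := by
  rw [← image_nonempty (f := label), hq.image_label_vertexSet]
  exact nonempty_of_mem (q e).mem

theorem IsCovering.exists_vertexSet_eq (hq : IsCovering q) {e : E}
    {A : Set (VertexLift (FacePoset.vertex K) q)} (hA : A ⊆ vertexSet q e) (hne : A.Nonempty) :
    ∃ e', vertexSet q e' = A := by
  obtain ⟨s, hs⟩ := ((hq.finite_vertexSet e).subset hA).image label |>.exists_finset_coe
  have hse : (s : Set V) ⊆ (q e).simplex := by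
    rw [hs, ← hq.image_label_vertexSet]
    exact image_mono hA
  have hsK : s ∈ K := ((inFace_coe (q e).mem).mono hse).mem
    (Finset.coe_nonempty.1 (hs ▸ hne.image label))
  obtain ⟨e', he', hqe'⟩ := hq.exists_lift_below
    (FacePoset.specializes_iff.2 hse : (⟨s, hsK⟩ : FacePoset K) ⤳ q e)
  have hsub : vertexSet q e' ⊆ vertexSet q e := fun w hw => hw.trans he'
  refine ⟨e', ((hq.label_injOn_vertexSet e).image_eq_image_iff hsub hA).1 ?_⟩
  rw [hq.image_label_vertexSet, hqe', hs]

theorem IsCovering.vertexSet_subset_iff (hq : IsCovering q) {e e' : E} :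
    vertexSet q e ⊆ vertexSet q e' ↔ e ⤳ e' := by
  refine ⟨fun h => ?_, fun h w hw => hw.trans h⟩
  have hqe : q e ⤳ q e' := by
    rw [FacePoset.specializes_iff, ← hq.image_label_vertexSet, ← hq.image_label_vertexSet]
    exact image_mono h
  obtain ⟨z, hz, hqz⟩ := hq.exists_lift_below hqe
  have vertexSet_eq : vertexSet q z = vertexSet q e :=
    ((hq.label_injOn_vertexSet e').image_eq_image_iff (fun w hw => hw.trans hz) h).1
      (by rw [hq.image_label_vertexSet, hq.image_label_vertexSet, hqz])
  obtain ⟨w, hw⟩ := hq.vertexSet_nonempty e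
  rwa [← hq.eq_of_above (vertexSet_eq.superset hw) hw hqz]

/-- The complex that the covering `q` of the face poset of `K` comes from. -/
def vertexSetComplex (hq : IsCovering q) :
    AbstractSimplicialComplex (VertexLift (FacePoset.vertex K) q) where
  faces := {t | ∃ e, vertexSet q e = t}
  isRelLowerSet_faces := by
    rintro t ⟨e, ht⟩
    exact ⟨Finset.coe_nonempty.1 (ht ▸ hq.vertexSet_nonempty e),
      fun s hst hs => hq.exists_vertexSet_eq (ht ▸ Finset.coe_subset.2 hst) hs⟩
  singleton_mem w := hq.exists_vertexSet_eq (e := w.1)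
    (by simp [vertexSet, specializes_rfl]) (Finset.singleton_nonempty w)

/-- The simplicial map from `vertexSetComplex hq` to `K`. -/
noncomputable def vertexSetComplexMap (hq : IsCovering q) :
    SimplicialMap (vertexSetComplex hq) K :=
  .ofInFace label fun t ⟨e, ht⟩ => by
    rw [← ht, hq.image_label_vertexSet]
    exact inFace_coe (q e).mem

variable {hq : IsCovering q}

theorem exists_vertexSet_eq_of_inFace {A : Set (VertexLift (FacePoset.vertex K) q)}
    (h : InFace (vertexSetComplex hq) A) (hne : A.Nonempty) : ∃ e, vertexSet q e = A :=
  let ⟨_, ⟨_, he⟩, hAt⟩ := h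
  hq.exists_vertexSet_eq (he ▸ hAt) hne

theorem isCombCovering_vertexSetComplexMap : IsCombCovering (vertexSetComplexMap hq) where
  surjective v := by
    obtain ⟨e, he⟩ := hq.2 (FacePoset.vertex K v)
    exact ⟨⟨e, v, he.symm⟩, label_eq FacePoset.vertex_injective he⟩
  eq_of_inFace {w x y} hx hy hxy := by
    obtain ⟨e, he⟩ := exists_vertexSet_eq_of_inFace hx (insert_nonempty _ _)
    obtain ⟨e', he'⟩ := exists_vertexSet_eq_of_inFace hy (insert_nonempty _ _)
    have hqe : q e = q e' := FacePoset.ext_coe <| by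
      rw [← hq.image_label_vertexSet, ← hq.image_label_vertexSet, he, he', image_pair, image_pair]
      exact congrArg (fun v => ({w.label, v} : Set V)) hxy
    have hwe : w ∈ vertexSet q e := he.superset (mem_insert _ _)
    have hwe' : w ∈ vertexSet q e' := he'.superset (mem_insert _ _)
    obtain rfl : e = e' := hq.eq_of_above hwe hwe' hqe
    exact hq.label_injOn_vertexSet e (he.superset (mem_insert_of_mem _ rfl))
      (he'.superset (mem_insert_of_mem _ rfl)) hxy
  exists_lift w s hs hw := by
    have hws : q w.1 ⤳ ⟨s, hs⟩ := by
      rw [← w.apply_label]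
      exact FacePoset.vertex_specializes.2 hw
    obtain ⟨e, hwe, hqe⟩ := hq.exists_lift_above hws
    obtain ⟨t, ht⟩ := (hq.finite_vertexSet e).exists_finset_coe
    refine ⟨t, ⟨e, ht.symm⟩, ht.superset hwe, ?_⟩
    rw [ht]
    exact (hq.image_label_vertexSet e).trans (by rw [hqe])

theorem exists_homeomorph_facePoset_vertexSetComplex (hq : IsCovering q) :
    ∃ h : E ≃ₜ FacePoset (vertexSetComplex hq),
      ∀ e, (vertexSetComplexMap hq).facePoset (h e) = q e := by
  choose t ht using fun e => (hq.finite_vertexSet e).exists_finset_coe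
  let f (e : E) : FacePoset (vertexSetComplex hq) := ⟨t e, e, (ht e).symm⟩
  have specializes_iff (e e' : E) : f e ⤳ f e' ↔ e ⤳ e' := by
    rw [FacePoset.specializes_iff, ht, ht, hq.vertexSet_subset_iff]
  have hbij : Bijective f := by
    constructor
    · intro e e' h
      have := hq.t0Space
      exact (((specializes_iff e e').1 (specializes_of_eq h)).antisymm
        ((specializes_iff e' e).1 (specializes_of_eq h.symm))).eq
    · rintro ⟨s, e, he⟩
      exact ⟨e, FacePoset.ext_coe ((ht e).trans he)⟩
  have := hq.alexandrovDiscrete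
  obtain ⟨h, hh⟩ := exists_homeomorph_of_specializes_iff (.ofBijective f hbij) specializes_iff
  refine ⟨h, fun e => FacePoset.ext_coe ?_⟩
  rw [SimplicialMap.coe_facePoset_simplex, hh, ← hq.image_label_vertexSet, ← ht]
  rfl

end VertexSet

theorem exists_mk_facePoset_eq {V : Type u} {K : AbstractSimplicialComplex V}
    (c : CoveringClass.{u, v} (FacePoset K)) :
    ∃ (W : Type v) (L : AbstractSimplicialComplex W) (φ : SimplicialMap L K)
      (hφ : IsCombCovering φ), CoveringClass.mk φ.facePoset hφ.isCovering_facePoset = c := by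
  obtain ⟨E, _, q, hq, rfl⟩ := c.exists_mk_eq
  obtain ⟨h, hh⟩ := exists_homeomorph_facePoset_vertexSetComplex hq
  exact ⟨_, _, vertexSetComplexMap hq, isCombCovering_vertexSetComplexMap,
    (CoveringClass.mk_eq_mk_iff _ hq).2 ⟨h.symm, fun σ => by rw [← hh, h.apply_symm_apply]⟩⟩

/-! ### The two bijections -/

section OrderComplexClass

variable {B : Type u} [TopologicalSpace B] [AlexandrovDiscrete B]

theorem mk_realization_orderComplexMap_eq_iff {E E' : Type v} [TopologicalSpace E]
    [TopologicalSpace E'] {p : C(E, B)} {p' : C(E', B)} (hp : IsCovering p) (hp' : IsCovering p') :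
    CoveringClass.mk (orderComplexMap p).realization hp.isCombCovering_orderComplexMap.isCovering =
      CoveringClass.mk (orderComplexMap p').realization
        hp'.isCombCovering_orderComplexMap.isCovering ↔
      CoveringClass.mk p hp = CoveringClass.mk p' hp' := by
  rw [mk_realization_eq_iff, isoOver_orderComplexMap_iff hp hp', CoveringClass.mk_eq_mk_iff]

theorem exists_mk_realization_orderComplexMap_eq
    (c : CoveringClass.{u, v} (Realization (orderComplex B))) :
    ∃ (E : Type v) (_ : TopologicalSpace E) (p : C(E, B)) (hp : IsCovering p),
      CoveringClass.mk (orderComplexMap p).realization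
        hp.isCombCovering_orderComplexMap.isCovering = c := by
  obtain ⟨W, L, φ, hφ, rfl⟩ := exists_mk_realization_eq c
  obtain ⟨_, p, hp, hpφ⟩ := hφ.isCombCovering.exists_orderComplexMap_isoOver
  exact ⟨W, _, p, hp, (mk_realization_eq_iff _ hφ).2 hpφ⟩

variable (B) in
theorem exists_bijective_mk_realization_orderComplexMap :
    ∃ Φ : CoveringClass.{u, v} B → CoveringClass.{u, v} (Realization (orderComplex B)),
      Bijective Φ ∧
      ∀ (E : Type v) [TopologicalSpace E] (p : C(E, B)) (hp : IsCovering p)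
        (hKp : IsCovering (orderComplexMap p).realization),
        Φ (CoveringClass.mk p hp) = CoveringClass.mk (orderComplexMap p).realization hKp := by
  let toMap (c : Covering.{u, v} B) : C(c.total, B) := ⟨c.proj, c.isCovering.continuous⟩
  have isCovering_toMap (c : Covering.{u, v} B) : IsCovering (toMap c) := c.isCovering
  obtain ⟨Φ, hΦ, hΦ_mk⟩ := exists_bijective_comp_eq
    (a := fun c => CoveringClass.mk (toMap c) (isCovering_toMap c))
    (b := fun c => CoveringClass.mk (orderComplexMap (toMap c)).realization
      (isCovering_toMap c).isCombCovering_orderComplexMap.isCovering)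
    Quotient.mk_surjective
    (fun c => by
      obtain ⟨E, _, p, hp, rfl⟩ := exists_mk_realization_orderComplexMap_eq c
      exact ⟨⟨E, p, hp⟩, rfl⟩)
    fun c c' => (mk_realization_orderComplexMap_eq_iff _ _).symm
  exact ⟨Φ, hΦ, fun E _ p hp _ => hΦ_mk ⟨E, p, hp⟩⟩

end OrderComplexClass

section FacePosetClass

variable {V : Type u} {K : AbstractSimplicialComplex V}

variable (K) in
/-- A simplicial covering of `K`, together with its total complex. -/
structure SimplicialCovering where
  vertices : Type v
  total : AbstractSimplicialComplex vertices
  proj : SimplicialMap total K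
  isCovering : IsCovering proj.realization

namespace SimplicialCovering

variable (c c' : SimplicialCovering.{u, v} K)

theorem isCovering_facePoset : IsCovering c.proj.facePoset :=
  c.isCovering.isCombCovering.isCovering_facePoset

theorem mk_realization_eq_iff_mk_facePoset_eq :
    CoveringClass.mk c.proj.realization c.isCovering =
      CoveringClass.mk c'.proj.realization c'.isCovering ↔
    CoveringClass.mk c.proj.facePoset c.isCovering_facePoset =
      CoveringClass.mk c'.proj.facePoset c'.isCovering_facePoset :=
  (mk_realization_eq_iff c.isCovering c'.isCovering).trans
    (mk_facePoset_eq_iff c.isCovering.isCombCovering c'.isCovering.isCombCovering).symm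

end SimplicialCovering

variable (K) in
theorem exists_bijective_mk_facePoset :
    ∃ Φ : CoveringClass.{u, v} (Realization K) → CoveringClass.{u, v} (FacePoset K),
      Bijective Φ ∧
      ∀ (W : Type v) (L : AbstractSimplicialComplex W) (φ : SimplicialMap L K)
        (hφ : IsCovering φ.realization) (hXφ : IsCovering φ.facePoset),
        Φ (CoveringClass.mk φ.realization hφ) = CoveringClass.mk φ.facePoset hXφ := by
  obtain ⟨Φ, hΦ, hΦ_mk⟩ := exists_bijective_comp_eq
    (a := fun c : SimplicialCovering.{u, v} K =>
      CoveringClass.mk c.proj.realization c.isCovering)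
    (b := fun c => CoveringClass.mk c.proj.facePoset c.isCovering_facePoset)
    (fun c => by
      obtain ⟨W, L, φ, hφ, rfl⟩ := exists_mk_realization_eq c
      exact ⟨⟨W, L, φ, hφ⟩, rfl⟩)
    (fun c => by
      obtain ⟨W, L, φ, hφ, rfl⟩ := exists_mk_facePoset_eq c
      exact ⟨⟨W, L, φ, hφ.isCovering⟩, rfl⟩)
    SimplicialCovering.mk_realization_eq_iff_mk_facePoset_eq
  exact ⟨Φ, hΦ, fun W L φ hφ _ => hΦ_mk ⟨W, L, φ, hφ⟩⟩

end FacePosetClass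

end PosetCov

theorem theoremA10_general :
    (∀ (B : Type u) [TopologicalSpace B] [AlexandrovDiscrete B],
      (∀ (E : Type v) [TopologicalSpace E] (p : C(E, B)), IsCovering p →
        AlexandrovDiscrete E ∧ (T0Space B → T0Space E) ∧
          IsCovering (orderComplexMap p).realization) ∧
      ∃ Φ : CoveringClass.{u, v} B → CoveringClass.{u, v} (Realization (orderComplex B)),
        Function.Bijective Φ ∧
        ∀ (E : Type v) [TopologicalSpace E] (p : C(E, B)) (hp : IsCovering p)
          (hKp : IsCovering (orderComplexMap p).realization),
          Φ (CoveringClass.mk p hp) = CoveringClass.mk (orderComplexMap p).realization hKp) ∧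
    (∀ (V : Type u) (K : AbstractSimplicialComplex V),
      (∀ (W : Type v) (L : AbstractSimplicialComplex W) (φ : SimplicialMap L K),
        IsCovering φ.realization → IsCovering φ.facePoset) ∧
      (∀ c : CoveringClass.{u, v} (Realization K),
        ∃ (W : Type v) (L : AbstractSimplicialComplex W) (φ : SimplicialMap L K)
          (hφ : IsCovering φ.realization), CoveringClass.mk φ.realization hφ = c) ∧
      ∃ Φ : CoveringClass.{u, v} (Realization K) → CoveringClass.{u, v} (FacePoset K),
        Function.Bijective Φ ∧
        ∀ (W : Type v) (L : AbstractSimplicialComplex W) (φ : SimplicialMap L K)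
          (hφ : IsCovering φ.realization) (hXφ : IsCovering φ.facePoset),
          Φ (CoveringClass.mk φ.realization hφ) = CoveringClass.mk φ.facePoset hXφ) := by
  refine ⟨fun B _ _ => ⟨fun E _ p hp => ?_, exists_bijective_mk_realization_orderComplexMap B⟩,
    fun V K => ⟨fun W L φ hφ => ?_, exists_mk_realization_eq, exists_bijective_mk_facePoset K⟩⟩
  · exact ⟨hp.alexandrovDiscrete, fun _ => hp.t0Space, hp.isCombCovering_orderComplexMap.isCovering⟩
  · exact hφ.isCombCovering.isCovering_facePoset

theorem theoremA10 :
    -- the order complex functor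
    (∀ (B : Type u) [TopologicalSpace B] [AlexandrovDiscrete B] [T0Space B],
      (∀ (E : Type v) [TopologicalSpace E] (p : C(E, B)), IsCovering p →
        AlexandrovDiscrete E ∧ T0Space E ∧ IsCovering (orderComplexMap p).realization) ∧
      ∃ Φ : CoveringClass.{u, v} B → CoveringClass.{u, v} (Realization (orderComplex B)),
        Function.Bijective Φ ∧
        ∀ (E : Type v) [TopologicalSpace E] (p : C(E, B)) (hp : IsCovering p)
          (hKp : IsCovering (orderComplexMap p).realization),
          Φ (CoveringClass.mk p hp) = CoveringClass.mk (orderComplexMap p).realization hKp) ∧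
    -- the face poset functor
    (∀ (V : Type u) (K : AbstractSimplicialComplex V),
      (∀ (W : Type v) (L : AbstractSimplicialComplex W) (φ : SimplicialMap L K),
        IsCovering φ.realization → IsCovering φ.facePoset) ∧
      (∀ c : CoveringClass.{u, v} (Realization K),
        ∃ (W : Type v) (L : AbstractSimplicialComplex W) (φ : SimplicialMap L K)
          (hφ : IsCovering φ.realization), CoveringClass.mk φ.realization hφ = c) ∧
      ∃ Φ : CoveringClass.{u, v} (Realization K) → CoveringClass.{u, v} (FacePoset K),
        Function.Bijective Φ ∧
        ∀ (W : Type v) (L : AbstractSimplicialComplex W) (φ : SimplicialMap L K)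
          (hφ : IsCovering φ.realization) (hXφ : IsCovering φ.facePoset),
          Φ (CoveringClass.mk φ.realization hφ) = CoveringClass.mk φ.facePoset hXφ) :=
  ⟨fun B _ _ _ => (theoremA10_general.1 B).imp_left fun h E _ p hp =>
    (h E p hp).imp_right (.imp_left (· ‹_›)), theoremA10_general.2⟩
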